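/- Let $G = SL_3(\mathbb R)$, $K = SO(3)$, let $N$ be the group of upper triangular unipotent matrices and $A$ the group of diagonal matrices with positive entries in $G$. Let $\mathfrak a$ be the space of diagonal matrices of trace $0$ and $\mathfrak k$ the space of skew-symmetric matrices in $M_3(\mathbb R)$, both with the restriction $\|\cdot\|$ of the Euclidean norm of $M_3(\mathbb R) \cong \mathbb R^9$, and with closed unit balls $B_{\mathfrak a}$, $B_{\mathfrak k}$; let $\mathfrak a^*$ carry the dual norm, and let $\mathfrak a^*_r \subset \mathfrak a^*$ be the set of regular elements (those orthogonal to no root). Let $M$ be the centraliser of $\mathfrak a$ in $K$. For $g \in G$ let $A(g) \in \mathfrak a$ be the unique element with $g \in N \exp(A(g)) K$. Let $dH$ be a Haar (Lebesgue) measure on $\mathfrak a$. Proposition. Let $\epsilon > 0$ and $A_0 \in \mathbb R$. There is an integer $n = n(\epsilon, A_0) \ge 0$ with the following property. Let $B^* \subset \mathfrak a^*_r$ and $D_B \subset NA$ be compact sets, let $C > 0$ and $R \in \mathbb R$. Then there is a constant $c$, depending only on $\epsilon, A_0, B^*, D_B, C, R$ (and on the normalisation of $dH$), such that for every $b \in C_0^\infty(\mathfrak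 a)$ with $\mathrm{supp}(b) \subseteq B_{\mathfrak a}$ all of whose derivatives of order at most $n$ are bounded by $R$ in norm, for all real $t > 0$ and $\beta$ with $1 \le \beta \le t^{1/2}$, all $\lambda, \nu \in B^*$ with $\|\lambda - \nu\| \le \beta/t$, all $k \in K$ with $$k \notin M \exp\bigl( C t^{-1/2+\epsilon} \beta^{1/2} B_{\mathfrak k} \bigr),$$ and all $g \in D_B$, we have $$\left| \int_{\mathfrak a} b(H) \exp\bigl( -it\lambda(H) + it\nu(A(kg\exp(H))) \bigr)\, dH \right| \le c\, t^{-A_0}.$$ -/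

import Mathlib

open scoped Matrix Pointwise ContDiff

noncomputable section

namespace SL3Flat

/-- The group `SL₃(ℝ)`. -/
abbrev G : Type := Matrix.SpecialLinearGroup (Fin 3) ℝ

/-- `K = SO(3)`, as a subset of `SL₃(ℝ)`. -/
def K : Set G := {k | (k : Matrix (Fin 3) (Fin 3) ℝ) * (k : Matrix (Fin 3) (Fin 3) ℝ)ᵀ = 1}

/-- `N`: the upper triangular unipotent matrices. -/
def N : Set G := {n | (∀ i, n.1 i i = 1) ∧ ∀ i j, j < i → n.1 i j = 0}

/-- `A`: the diagonal matrices with positive entries in `SL₃(ℝ)`. -/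
def A : Set G := {a | (∀ i, 0 < a.1 i i) ∧ ∀ i j, i ≠ j → a.1 i j = 0}

/-- The diagonal matrices of trace zero, as a subspace of `M₃(ℝ)`. -/
def diagTraceZero : Submodule ℝ (Matrix (Fin 3) (Fin 3) ℝ) where
  carrier := {H | (∀ i j, i ≠ j → H i j = 0) ∧ H.trace = 0}
  zero_mem' := by simp
  add_mem' := by
    rintro X Y ⟨hX, hX'⟩ ⟨hY, hY'⟩
    exact ⟨fun i j h => by simp [hX i j h, hY i j h], by simp [hX', hY']⟩
  smul_mem' := by
    rintro c X ⟨hX, hX'⟩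
    exact ⟨fun i j h => by simp [hX i j h], by simp [hX']⟩

/-- The skew-symmetric matrices, as a subspace of `M₃(ℝ)`. -/
def skewSymm : Submodule ℝ (Matrix (Fin 3) (Fin 3) ℝ) where
  carrier := {X | Xᵀ = -X}
  zero_mem' := by simp
  add_mem' := by
    intro X Y hX hY
    simp only [Set.mem_ofPred_eq] at hX hY ⊢
    rw [Matrix.transpose_add, hX, hY, neg_add]
  smul_mem' := by
    intro c X hX
    simp only [Set.mem_ofPred_eq] at hX ⊢
    rw [Matrix.transpose_smul, hX, smul_neg]

/-- `𝔞`, the Lie algebra of `A`: the diagonal matrices of trace zero. -/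
def lieA : Type := diagTraceZero

/-- `𝔨`, the Lie algebra of `SO(3)`: the skew-symmetric matrices. -/
def lieK : Type := skewSymm

section Norms

open scoped Matrix.Norms.Frobenius

/-- `𝔞` carries the restriction of the Euclidean (Frobenius) norm of `M₃(ℝ)`. -/
instance : NormedAddCommGroup lieA := inferInstanceAs (NormedAddCommGroup diagTraceZero)

instance : NormedSpace ℝ lieA := inferInstanceAs (NormedSpace ℝ diagTraceZero)

/-- `𝔨` carries the restriction of the Euclidean (Frobenius) norm of `M₃(ℝ)`. -/
instance : NormedAddCommGroup lieK := inferInstanceAs (NormedAddCommGroup skewSymm)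

instance : NormedSpace ℝ lieK := inferInstanceAs (NormedSpace ℝ skewSymm)

lemma norm_lieA (H : lieA) : ‖H‖ = √(∑ i, ∑ j, H.1 i j ^ 2) := by
  change ‖H.1‖ = _
  simp [Matrix.frobenius_norm_def, Real.sqrt_eq_rpow]

lemma norm_lieK (X : lieK) : ‖X‖ = √(∑ i, ∑ j, X.1 i j ^ 2) := by
  change ‖X.1‖ = _
  simp [Matrix.frobenius_norm_def, Real.sqrt_eq_rpow]

end Norms

instance : FiniteDimensional ℝ lieA := inferInstanceAs (FiniteDimensional ℝ diagTraceZero)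

/-- `𝔞` carries its Borel σ-algebra. -/
instance : MeasurableSpace lieA := borel lieA

instance : BorelSpace lieA := ⟨rfl⟩

/-- `M`: the centraliser of `𝔞` in `K = SO(3)`. -/
def M : Set G := {m | m ∈ K ∧ ∀ H : lieA, m.1 * H.1 = H.1 * m.1}

lemma lieA_eq_diagonal (H : lieA) :
    H.1 = Matrix.diagonal (fun i => H.1 i i) := by
  ext i j
  by_cases h : i = j
  · subst h; simp
  · rw [Matrix.diagonal_apply_ne _ h]; exact H.2.1 i j h

lemma exp_lieA (H : lieA) :
    NormedSpace.exp H.1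
      = Matrix.diagonal (fun i => Real.exp (H.1 i i)) := by
  conv_lhs => rw [lieA_eq_diagonal H]
  rw [Matrix.exp_diagonal]
  congr 1
  funext i
  rw [Pi.coe_exp, Real.exp_eq_exp_ℝ]

lemma det_exp_lieA (H : lieA) : (NormedSpace.exp H.1).det = 1 := by
  rw [exp_lieA, Matrix.det_diagonal, ← Real.exp_sum]
  have h : ∑ i, H.1 i i = 0 := H.2.2
  rw [h, Real.exp_zero]

/-- The exponential map `𝔞 → SL₃(ℝ)`. -/
def expA (H : lieA) : G := ⟨NormedSpace.exp H.1, det_exp_lieA H⟩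

lemma exp_lieK_mul_transpose (X : lieK) :
    NormedSpace.exp X.1
      * (NormedSpace.exp X.1)ᵀ = 1 := by
  have hX : X.1ᵀ = -X.1 := X.2
  rw [← Matrix.exp_transpose, hX, ← Matrix.exp_add_of_commute _ _ ((Commute.refl X.1).neg_right),
    add_neg_cancel, NormedSpace.exp_zero]

lemma det_exp_lieK (X : lieK) : (NormedSpace.exp X.1).det = 1 := by
  have h1 := congrArg Matrix.det (exp_lieK_mul_transpose X)
  rw [Matrix.det_mul, Matrix.det_transpose, Matrix.det_one] at h1
  have h2 : NormedSpace.exp X.1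
      = NormedSpace.exp ((1 / 2 : ℝ) • X.1)
        * NormedSpace.exp ((1 / 2 : ℝ) • X.1) := by
    rw [← Matrix.exp_add_of_commute _ _ (Commute.refl _), ← add_smul]
    norm_num
  have h3 := congrArg Matrix.det h2
  rw [Matrix.det_mul] at h3
  nlinarith [mul_self_nonneg
    (NormedSpace.exp ((1 / 2 : ℝ) • X.1)).det]

/-- The exponential map `𝔨 → SL₃(ℝ)`. -/
def expK (X : lieK) : G := ⟨NormedSpace.exp X.1, det_exp_lieK X⟩

lemma mem_N_iff {n : G} : n ∈ N ↔ n.1 0 0 = 1 ∧ n.1 1 1 = 1 ∧ n.1 2 2 = 1 ∧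
    n.1 1 0 = 0 ∧ n.1 2 0 = 0 ∧ n.1 2 1 = 0 := by
  constructor
  · rintro ⟨h1, h2⟩
    exact ⟨h1 0, h1 1, h1 2, h2 1 0 (by decide), h2 2 0 (by decide), h2 2 1 (by decide)⟩
  · rintro ⟨h0, h1, h2, h3, h4, h5⟩
    refine ⟨fun i => by fin_cases i <;> assumption, fun i j hij => ?_⟩
    fin_cases i <;> fin_cases j <;> first | assumption | (exact absurd hij (by decide))

lemma exists_lieA (x y z : ℝ) (h : x + y + z = 0) :
    ∃ H : lieA, H.1 0 0 = x ∧ H.1 1 1 = y ∧ H.1 2 2 = z := by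
  refine ⟨⟨Matrix.diagonal ![x, y, z], ?_, ?_⟩, ?_, ?_, ?_⟩
  · intro i j hij
    exact Matrix.diagonal_apply_ne _ hij
  · simpa [Matrix.trace_diagonal, Fin.sum_univ_three] using h
  all_goals simp

lemma exists_iwasawa (g : G) : ∃ H : lieA, ∃ n ∈ N, ∃ k ∈ K, g = n * expA H * k := by
  have hdet := g.2
  rw [Matrix.det_fin_three] at hdet
  obtain ⟨S, hS⟩ : ∃ S : Matrix (Fin 3) (Fin 3) ℝ, S = g.1 * g.1ᵀ := ⟨_, rfl⟩
  have hSdet : S.det = 1 := by rw [hS, Matrix.det_mul, Matrix.det_transpose, g.2, one_mul]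
  have hST : Sᵀ = S := by rw [hS, Matrix.transpose_mul, Matrix.transpose_transpose]
  have e : ∀ i j, S i j = g.1 i 0 * g.1 j 0 + g.1 i 1 * g.1 j 1 + g.1 i 2 * g.1 j 2 := by
    intro i j
    rw [hS, Matrix.mul_apply, Fin.sum_univ_three]
    simp only [Matrix.transpose_apply]
  have s10 : S 1 0 = S 0 1 := congrFun (congrFun hST 0) 1
  have s20 : S 2 0 = S 0 2 := congrFun (congrFun hST 0) 2
  have s21 : S 2 1 = S 1 2 := congrFun (congrFun hST 1) 2
  have hq : 0 < S 1 1 * S 2 2 - S 1 2 ^ 2 := by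
    have hlag : S 1 1 * S 2 2 - S 1 2 ^ 2
        = (g.1 1 1 * g.1 2 2 - g.1 1 2 * g.1 2 1) ^ 2
          + (g.1 1 2 * g.1 2 0 - g.1 1 0 * g.1 2 2) ^ 2
          + (g.1 1 0 * g.1 2 1 - g.1 1 1 * g.1 2 0) ^ 2 := by
      rw [e 1 1, e 2 2, e 1 2]; ring
    by_contra hcon
    rw [hlag] at hcon
    have c0 : g.1 1 1 * g.1 2 2 - g.1 1 2 * g.1 2 1 = 0 := by nlinarith
    have c1 : g.1 1 2 * g.1 2 0 - g.1 1 0 * g.1 2 2 = 0 := by nlinarith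
    have c2 : g.1 1 0 * g.1 2 1 - g.1 1 1 * g.1 2 0 = 0 := by nlinarith
    have : (1 : ℝ) = 0 := by
      rw [← hdet]
      linear_combination g.1 0 0 * c0 + g.1 0 1 * c1 + g.1 0 2 * c2
    exact one_ne_zero this
  have hp : 0 < S 2 2 := by
    have h2 : 0 ≤ S 2 2 := by rw [e 2 2]; nlinarith [sq_nonneg (g.1 2 0), sq_nonneg (g.1 2 1)]
    rcases h2.lt_or_eq with h | h
    · exact h
    · rw [← h] at hq
      nlinarith [sq_nonneg (S 1 2)]
  obtain ⟨p, hp'⟩ : ∃ p, p = S 2 2 := ⟨_, rfl⟩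
  obtain ⟨q, hq'⟩ : ∃ q, q = S 1 1 * S 2 2 - S 1 2 ^ 2 := ⟨_, rfl⟩
  rw [← hp'] at hp
  rw [← hq'] at hq
  obtain ⟨H, h0, h1, h2⟩ := exists_lieA (-Real.log q / 2) ((Real.log q - Real.log p) / 2)
    (Real.log p / 2) (by ring)
  have sq0 : Real.exp (H.1 0 0) ^ 2 = 1 / q := by
    rw [h0, ← Real.exp_nat_mul, ← Real.exp_log (one_div_pos.2 hq), one_div, Real.log_inv]
    congr 1; push_cast; ring
  have sq1 : Real.exp (H.1 1 1) ^ 2 = q / p := by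
    rw [h1, ← Real.exp_nat_mul, ← Real.exp_log (div_pos hq hp), Real.log_div hq.ne' hp.ne']
    congr 1; push_cast; ring
  have sq2 : Real.exp (H.1 2 2) ^ 2 = p := by
    rw [h2, ← Real.exp_nat_mul]
    conv_rhs => rw [← Real.exp_log hp]
    congr 1; push_cast; ring
  let nm : Matrix (Fin 3) (Fin 3) ℝ :=
    !![1, (S 0 1 * p - S 0 2 * S 1 2) / q, S 0 2 / p; 0, 1, S 1 2 / p; 0, 0, 1]
  let n : G := ⟨nm, by simp [nm, Matrix.det_fin_three]⟩
  have hn : n ∈ N := by rw [mem_N_iff]; simp [n, nm]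
  have key : nm * Matrix.diagonal (fun i => Real.exp (H.1 i i))
      * (nm * Matrix.diagonal (fun i => Real.exp (H.1 i i)))ᵀ = S := by
    rw [Matrix.det_fin_three, s10, s20, s21, ← hp'] at hSdet
    rw [← hp'] at hq'
    have hqne := hq.ne'
    have hpne := hp.ne'
    have E : ∀ i j, (nm * Matrix.diagonal (fun i => Real.exp (H.1 i i))
      * (nm * Matrix.diagonal (fun i => Real.exp (H.1 i i)))ᵀ) i j
        = nm i 0 * nm j 0 * (1 / q) + nm i 1 * nm j 1 * (q / p) + nm i 2 * nm j 2 * p := by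
      intro i j
      rw [Matrix.mul_apply, Fin.sum_univ_three, ← sq0, ← sq1]
      conv_rhs => rw [← sq2]
      simp only [Matrix.transpose_apply, Matrix.mul_diagonal]
      ring
    ext i j
    rw [E i j]
    fin_cases i <;> fin_cases j <;> simp [nm, s10, s20, s21, ← hp'] <;> field_simp
    · linear_combination -p * hSdet + (S 0 2 ^ 2 - S 0 0 * p) * hq'
    all_goals first | (ring1) | (linear_combination hq')
  have key' : (n * expA H).1 * (n * expA H).1ᵀ = g.1 * g.1ᵀ := by
    rw [← hS, ← key, Matrix.SpecialLinearGroup.coe_mul]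
    change nm * NormedSpace.exp H.1 * (nm * NormedSpace.exp H.1)ᵀ = _
    rw [exp_lieA]
  refine ⟨H, n, hn, (n * expA H)⁻¹ * g, ?_, by group⟩
  generalize n * expA H = T at key'
  have hT : (T⁻¹).1 * T.1 = 1 := by
    rw [← Matrix.SpecialLinearGroup.coe_mul, inv_mul_cancel, Matrix.SpecialLinearGroup.coe_one]
  change (T⁻¹ * g).1 * (T⁻¹ * g).1ᵀ = 1
  rw [Matrix.SpecialLinearGroup.coe_mul, Matrix.transpose_mul]
  calc (T⁻¹).1 * g.1 * (g.1ᵀ * (T⁻¹).1ᵀ) = (T⁻¹).1 * (g.1 * g.1ᵀ) * (T⁻¹).1ᵀ := by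
        simp only [Matrix.mul_assoc]
    _ = ((T⁻¹).1 * T.1) * ((T⁻¹).1 * T.1)ᵀ := by
        rw [← key', Matrix.transpose_mul]; simp only [Matrix.mul_assoc]
    _ = 1 := by rw [hT]; simp

lemma iwasawa_unique {H H' : lieA} {n n' k k' : G} (hn : n ∈ N) (hn' : n' ∈ N)
    (hk : k ∈ K) (hk' : k' ∈ K) (h : n * expA H * k = n' * expA H' * k') : H = H' := by
  have gram : ∀ {H : lieA} {n k : G}, n ∈ N → k ∈ K →
      ((n * expA H * k).1 * (n * expA H * k).1ᵀ) 2 2 = Real.exp (H.1 2 2) ^ 2 ∧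
      ((n * expA H * k).1 * (n * expA H * k).1ᵀ) 1 1
          * ((n * expA H * k).1 * (n * expA H * k).1ᵀ) 2 2
          - ((n * expA H * k).1 * (n * expA H * k).1ᵀ) 1 2 ^ 2
        = Real.exp (H.1 1 1) ^ 2 * Real.exp (H.1 2 2) ^ 2 := by
    intro H n k hn hk
    have hk : k.1 * k.1ᵀ = 1 := hk
    have e1 : (n * expA H * k).1 * (n * expA H * k).1ᵀ
        = n.1 * Matrix.diagonal (fun i => Real.exp (H.1 i i))
          * (n.1 * Matrix.diagonal (fun i => Real.exp (H.1 i i)))ᵀ := by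
      rw [Matrix.SpecialLinearGroup.coe_mul, Matrix.SpecialLinearGroup.coe_mul]
      change n.1 * NormedSpace.exp H.1 * k.1 * (n.1 * NormedSpace.exp H.1 * k.1)ᵀ = _
      rw [exp_lieA, Matrix.transpose_mul _ k.1, Matrix.mul_assoc, ← Matrix.mul_assoc k.1, hk,
        Matrix.one_mul]
    rw [mem_N_iff] at hn
    obtain ⟨a0, a1, a2, a3, a4, a5⟩ := hn
    have E : ∀ i j, (n.1 * Matrix.diagonal (fun i => Real.exp (H.1 i i))
      * (n.1 * Matrix.diagonal (fun i => Real.exp (H.1 i i)))ᵀ) i j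
        = n.1 i 0 * n.1 j 0 * Real.exp (H.1 0 0) ^ 2 + n.1 i 1 * n.1 j 1 * Real.exp (H.1 1 1) ^ 2
          + n.1 i 2 * n.1 j 2 * Real.exp (H.1 2 2) ^ 2 := by
      intro i j
      rw [Matrix.mul_apply, Fin.sum_univ_three]
      simp only [Matrix.transpose_apply, Matrix.mul_diagonal]
      ring
    rw [e1, E 2 2, E 1 1, E 1 2, a1, a2, a3, a4, a5]
    constructor <;> ring
  have g1 := gram (H := H) hn hk
  have g2 := gram (H := H') hn' hk'
  rw [h] at g1
  have x2 : Real.exp (H.1 2 2) ^ 2 = Real.exp (H'.1 2 2) ^ 2 := g1.1.symm.trans g2.1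
  have x1 : Real.exp (H.1 1 1) ^ 2 * Real.exp (H.1 2 2) ^ 2
      = Real.exp (H'.1 1 1) ^ 2 * Real.exp (H'.1 2 2) ^ 2 := g1.2.symm.trans g2.2
  rw [x2] at x1
  have x1 := mul_right_cancel₀ (by positivity) x1
  rw [pow_left_inj₀ (by positivity) (by positivity) two_ne_zero, Real.exp_eq_exp] at x1 x2
  have t1 : H.1 0 0 + H.1 1 1 + H.1 2 2 = 0 := by
    rw [← Fin.sum_univ_three (fun i => H.1 i i)]; exact H.2.2
  have t2 : H'.1 0 0 + H'.1 1 1 + H'.1 2 2 = 0 := by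
    rw [← Fin.sum_univ_three (fun i => H'.1 i i)]; exact H'.2.2
  have x0 : H.1 0 0 = H'.1 0 0 := by linarith
  apply Subtype.ext
  rw [lieA_eq_diagonal H, lieA_eq_diagonal H']
  congr 1
  funext i
  fin_cases i
  exacts [x0, x1, x2]

/-- The Iwasawa projection: `A(g) ∈ 𝔞` is the (unique) element with `g ∈ N exp(A(g)) K`. -/
def iwasawaA (g : G) : lieA := Classical.choose (exists_iwasawa g)

lemma iwasawaA_spec (g : G) : ∃ n ∈ N, ∃ k ∈ K, g = n * expA (iwasawaA g) * k :=
  Classical.choose_spec (exists_iwasawa g)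

lemma iwasawaA_eq {H : lieA} {n k : G} (hn : n ∈ N) (hk : k ∈ K) :
    iwasawaA (n * expA H * k) = H := by
  obtain ⟨n', hn', k', hk', h⟩ := iwasawaA_spec (n * expA H * k)
  exact (iwasawa_unique hn hn' hk hk' h).symm

/-- The coroot `E_ii - E_jj ∈ 𝔞` of the root `H ↦ H_ii - H_jj` (for `i ≠ j`). -/
def coroot (i j : Fin 3) : lieA :=
  ⟨Matrix.single i i 1 - Matrix.single j j 1, by
    constructor
    · intro a b hab
      simp only [Matrix.sub_apply, Matrix.single_apply]
      grind
    · simp [Matrix.trace_sub]⟩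

/-- The regular elements of `𝔞*`: those orthogonal to no root, i.e. vanishing on no coroot. -/
def regularDual : Set (StrongDual ℝ lieA) := {lam | ∀ i j, i ≠ j → lam (coroot i j) ≠ 0}

end SL3Flat

end

/-!
Write `h = k g`. The Iwasawa projection along the flat `h exp(𝔞)` is explicit: the last row of
`h exp(H)` and the first column of its inverse give (`iwasawaA_mul_expA_two`,
`iwasawaA_mul_expA_zero`)

  `A(h exp H)₂₂ = ½ log ∑ⱼ rⱼ² exp(2 Hⱼⱼ)`,  `A(h exp H)₀₀ = -½ log ∑ⱼ qⱼ² exp(-2 Hⱼⱼ)`,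

where `r` is the last row of `h`, `q` is the first column of `h⁻¹`, and `∑ⱼ qⱼ rⱼ = 0`. So the phase
is a combination of two log-sum-exp functions, and its derivatives are polynomials in the Gibbs
probabilities `Qⱼ ∝ qⱼ² exp(-2 Hⱼⱼ)` and `Rⱼ ∝ rⱼ² exp(2 Hⱼⱼ)`, which are the squared entries of the
first and last rows of the `K`-component of `h exp(H)`.

Let `D = (1 - Q₀) + (1 - R₂)` be the `defect`. Differentiate in the direction `v ∈ 𝔞` dual to `ν`.
Then `ν(v) - ∂ᵥ ν(A(h exp H)) = ½ ∑ᵢⱼ Sᵢⱼ (vᵢ - vⱼ)²`, with `S` the doubly stochastic matrix with rows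
`Q`, `1 - Q - R`, `R`, and regularity of `ν` makes this comparable to `D` (`half_mul_defect_le`,
`le_two_mul_defect`). The defect obeys a Harnack inequality on the unit ball (`defect_le`), hence
may be frozen at `H = 0`. All derivatives of the phase of order at least two are polynomials in
`Qᵢ`, `Rᵢ` times some `Qᵢ Qⱼ` or `Rᵢ Rⱼ` with `i ≠ j`, so they are `O(D)` as well
(`unifSmooth_gibbs_mul_gibbs_div`). After division by `D` the phase is therefore non-stationary in
the single direction `v`, with uniform bounds on its derivatives, and `n` integrations by parts
along `v` gain `(t D)⁻ⁿ` (`norm_integral_mul_le_of_unifSmooth`, `norm_integral_gibbsPhase_le`).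

It remains to bound `D` below. If `D` is small at `H = 0`, then, `g` being upper triangular and
bounded, the first and last rows of `k` are almost diagonal, so that `k` is at distance `O(√D)` from a
diagonal matrix of signs; taking logarithms near the identity gives `D ≳ min 1 r²` when
`k ∉ M exp(r B)` (`exists_le_defect`). With `r = C t^(-1/2+ε) β^(1/2)` this yields
`t D ≳ t ^ min 1 (2ε)`, and for large `t` also that `D` dominates the error `β / t` made in replacing
`λ` by `ν` (`le_min_one_sq`).
-/

/-! ### Families of functions with uniformly bounded directional derivatives -/

section UnifSmooth

variable {Θ E 𝔸 : Type*} [NormedAddCommGroup E] [NormedSpace ℝ E]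
  [NormedRing 𝔸] [NormedAlgebra ℝ 𝔸] {v : Θ → E} {U : Set E}

/-- `UnifSmooth v U n F`: on `U`, every member `F θ` of the family is continuous and `n` times
differentiable in its own direction `v θ`, and all these derivatives, of order `0` to `n`, are
continuous on `U` and bounded there independently of `θ`. The derivatives are quantified
existentially, so that their values outside `U` are irrelevant. -/
def UnifSmooth (v : Θ → E) (U : Set E) : ℕ → (Θ → E → 𝔸) → Prop
  | 0, F => (∃ C, ∀ θ, ∀ x ∈ U, ‖F θ x‖ ≤ C) ∧ ∀ θ, ContinuousOn (F θ) U
  | n + 1, F => ((∃ C, ∀ θ, ∀ x ∈ U, ‖F θ x‖ ≤ C) ∧ ∀ θ, ContinuousOn (F θ) U) ∧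
      ∃ F' : Θ → E → 𝔸, UnifSmooth v U n F' ∧
        ∀ θ, ∀ x ∈ U, HasLineDerivAt ℝ (F θ) (F' θ x) x (v θ)

namespace UnifSmooth

lemma base {n : ℕ} {F : Θ → E → 𝔸} (h : UnifSmooth v U n F) : UnifSmooth v U 0 F := by
  cases n with
  | zero => exact h
  | succ n => exact h.1

lemma pred {n : ℕ} {F : Θ → E → 𝔸} (h : UnifSmooth v U (n + 1) F) : UnifSmooth v U n F := by
  induction n generalizing F with
  | zero => exact h.1
  | succ n ih =>
    obtain ⟨h0, F', hF', hd⟩ := h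
    exact ⟨h0, F', ih hF', hd⟩

lemma congr (hU : IsOpen U) {n : ℕ} {F G : Θ → E → 𝔸} (h : UnifSmooth v U n F)
    (hFG : ∀ θ, ∀ x ∈ U, G θ x = F θ x) : UnifSmooth v U n G := by
  have key : ∀ {F G : Θ → E → 𝔸}, UnifSmooth v U 0 F → (∀ θ, ∀ x ∈ U, G θ x = F θ x) →
      UnifSmooth v U 0 G := by
    rintro F G ⟨⟨C, hC⟩, hc⟩ hFG
    exact ⟨⟨C, fun θ x hx => by rw [hFG θ x hx]; exact hC θ x hx⟩,
      fun θ => (hc θ).congr (hFG θ)⟩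
  cases n with
  | zero => exact key h hFG
  | succ n =>
    obtain ⟨h0, F', hF', hd⟩ := h
    refine ⟨key h0 hFG, F', hF', fun θ x hx => (hd θ x hx).congr_of_eventuallyEq ?_⟩
    filter_upwards [hU.mem_nhds hx] with y hy using hFG θ y hy

lemma const {a : Θ → 𝔸} {C : ℝ} (ha : ∀ θ, ‖a θ‖ ≤ C) (n : ℕ) :
    UnifSmooth v U n (fun θ _ => a θ) := by
  induction n generalizing a C with
  | zero => exact ⟨⟨C, fun θ _ _ => ha θ⟩, fun θ => continuousOn_const⟩
  | succ n ih =>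
    refine ⟨⟨⟨C, fun θ _ _ => ha θ⟩, fun θ => continuousOn_const⟩, fun _ _ => 0,
      ih (C := 0) (by simp), fun θ x _ => ?_⟩
    exact hasDerivAt_const (0 : ℝ) (a θ)

lemma add {n : ℕ} {F G : Θ → E → 𝔸} (hF : UnifSmooth v U n F) (hG : UnifSmooth v U n G) :
    UnifSmooth v U n (fun θ x => F θ x + G θ x) := by
  have key : ∀ {F G : Θ → E → 𝔸}, UnifSmooth v U 0 F → UnifSmooth v U 0 G →
      UnifSmooth v U 0 (fun θ x => F θ x + G θ x) := by
    rintro F G ⟨⟨C, hC⟩, hc⟩ ⟨⟨C', hC'⟩, hc'⟩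
    exact ⟨⟨C + C', fun θ x hx => (norm_add_le _ _).trans (add_le_add (hC θ x hx) (hC' θ x hx))⟩,
      fun θ => (hc θ).add (hc' θ)⟩
  induction n generalizing F G with
  | zero => exact key hF hG
  | succ n ih =>
    obtain ⟨h0, F', hF', hd⟩ := hF
    obtain ⟨h1, G', hG', hd'⟩ := hG
    exact ⟨key h0 h1, _, ih hF' hG', fun θ x hx => HasDerivAt.add (hd θ x hx) (hd' θ x hx)⟩

lemma mul {n : ℕ} {F G : Θ → E → 𝔸} (hF : UnifSmooth v U n F) (hG : UnifSmooth v U n G) :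
    UnifSmooth v U n (fun θ x => F θ x * G θ x) := by
  have key : ∀ {F G : Θ → E → 𝔸}, UnifSmooth v U 0 F → UnifSmooth v U 0 G →
      UnifSmooth v U 0 (fun θ x => F θ x * G θ x) := by
    rintro F G ⟨⟨C, hC⟩, hc⟩ ⟨⟨C', hC'⟩, hc'⟩
    refine ⟨⟨C * C', fun θ x hx => (norm_mul_le _ _).trans ?_⟩, fun θ => (hc θ).mul (hc' θ)⟩
    exact mul_le_mul (hC θ x hx) (hC' θ x hx) (norm_nonneg _)
      ((norm_nonneg _).trans (hC θ x hx))
  induction n generalizing F G with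
  | zero => exact key hF hG
  | succ n ih =>
    have hFn := hF.pred
    have hGn := hG.pred
    obtain ⟨h0, F', hF', hd⟩ := hF
    obtain ⟨h1, G', hG', hd'⟩ := hG
    refine ⟨key h0 h1, _, (ih hF' hGn).add (ih hFn hG'), fun θ x hx => ?_⟩
    have := HasDerivAt.mul (hd θ x hx) (hd' θ x hx)
    simp only [zero_smul, add_zero] at this
    exact this

lemma const_mul {n : ℕ} {F : Θ → E → 𝔸} (hF : UnifSmooth v U n F) {a : Θ → 𝔸} {C : ℝ}
    (ha : ∀ θ, ‖a θ‖ ≤ C) : UnifSmooth v U n (fun θ x => a θ * F θ x) :=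
  (const ha n).mul hF

lemma sum {ι : Type*} {n : ℕ} (s : Finset ι) {F : ι → Θ → E → 𝔸}
    (hF : ∀ i ∈ s, UnifSmooth v U n (F i)) : UnifSmooth v U n (fun θ x => ∑ i ∈ s, F i θ x) := by
  classical
  induction s using Finset.induction_on with
  | empty => simpa using const (v := v) (U := U) (a := fun _ => (0 : 𝔸)) (C := 0) (by simp) n
  | insert i s hi ih =>
    simp only [Finset.sum_insert hi]
    exact (hF i (Finset.mem_insert_self i s)).add
      (ih fun j hj => hF j (Finset.mem_insert_of_mem hj))

lemma ofReal {n : ℕ} {F : Θ → E → ℝ} (hF : UnifSmooth v U n F) :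
    UnifSmooth v U n (fun θ x => (F θ x : ℂ)) := by
  have key : ∀ {F : Θ → E → ℝ}, UnifSmooth v U 0 F →
      UnifSmooth v U 0 (fun θ x => (F θ x : ℂ)) := by
    rintro F ⟨⟨C, hC⟩, hc⟩
    exact ⟨⟨C, fun θ x hx => by simpa using hC θ x hx⟩,
      fun θ => Complex.continuous_ofReal.comp_continuousOn (hc θ)⟩
  induction n generalizing F with
  | zero => exact key hF
  | succ n ih =>
    obtain ⟨h0, F', hF', hd⟩ := hF
    exact ⟨key h0, _, ih hF', fun θ x hx => HasDerivAt.ofReal_comp (hd θ x hx)⟩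

/-- A bounded family solving a linear equation `∂F = G F` inherits all the smoothness of its
coefficient `G`. -/
lemma of_hasLineDerivAt_mul_self {F G : Θ → E → 𝔸} (h0 : UnifSmooth v U 0 F)
    (hd : ∀ θ, ∀ x ∈ U, HasLineDerivAt ℝ (F θ) (G θ x * F θ x) x (v θ))
    (hG : ∀ n, UnifSmooth v U n G) (n : ℕ) : UnifSmooth v U n F := by
  induction n with
  | zero => exact h0
  | succ n ih => exact ⟨h0, _, (hG n).mul ih, hd⟩

/-- A smooth function with bounded iterated derivatives is uniformly smooth in bounded
directions. -/
lemma of_iteratedFDeriv {f : Θ → E → 𝔸} (hf : ∀ θ, ContDiff ℝ ∞ (f θ)) {n : ℕ} {R V : ℝ}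
    (hv : ∀ θ, ‖v θ‖ ≤ V) (hR : ∀ θ, ∀ m ≤ n, ∀ x, ‖iteratedFDeriv ℝ m (f θ) x‖ ≤ R) :
    UnifSmooth v U n f := by
  have key : ∀ k m, m + k = n →
      UnifSmooth v U k (fun θ x => iteratedFDeriv ℝ m (f θ) x (fun _ => v θ)) := by
    intro k
    have base : ∀ m ≤ n,
        UnifSmooth v U 0 (fun θ x => iteratedFDeriv ℝ m (f θ) x (fun _ => v θ)) := by
      intro m hm
      refine ⟨⟨R * V ^ m, fun θ x _ => ?_⟩, fun θ => ?_⟩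
      · refine (ContinuousMultilinearMap.le_opNorm _ _).trans ?_
        rw [Finset.prod_const, Finset.card_univ, Fintype.card_fin]
        have h0 : 0 ≤ R := (norm_nonneg _).trans (hR θ m hm x)
        gcongr
        · exact hR θ m hm x
        · exact hv θ
      · have h1 : Continuous (iteratedFDeriv ℝ m (f θ)) :=
          (hf θ).continuous_iteratedFDeriv (by exact_mod_cast le_top)
        exact (h1.eval_const _).continuousOn
    induction k with
    | zero => intro m hm; exact base m (by omega)
    | succ k ih =>
      intro m hm
      refine ⟨base m (by omega), _, ih (m + 1) (by omega), fun θ x _ => ?_⟩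
      have h1 : DifferentiableAt ℝ (iteratedFDeriv ℝ m (f θ)) x :=
        (hf θ).differentiable_iteratedFDeriv (by exact_mod_cast WithTop.coe_lt_top m) x
      have h2 := (h1.hasFDerivAt.continuousMultilinear_apply_const
        (fun _ => v θ)).hasLineDerivAt (v θ)
      rw [iteratedFDeriv_succ_apply_left]
      exact h2
  have := key n 0 (by omega)
  simpa using this

/-- The family of reciprocals of a uniformly smooth family bounded away from zero. -/
lemma inv {F : Θ → E → ℝ} (hF : ∀ n, UnifSmooth v U n F) {δ : ℝ} (hδ : 0 < δ)
    (h : ∀ θ, ∀ x ∈ U, δ ≤ F θ x) (n : ℕ) : UnifSmooth v U n (fun θ x => (F θ x)⁻¹) := by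
  have h0 : UnifSmooth v U 0 (fun θ x => (F θ x)⁻¹) := by
    refine ⟨⟨δ⁻¹, fun θ x hx => ?_⟩, fun θ => ((hF 0).2 θ).inv₀ fun x hx =>
      (hδ.trans_le (h θ x hx)).ne'⟩
    have hp := hδ.trans_le (h θ x hx)
    rw [Real.norm_of_nonneg (by positivity)]
    exact inv_anti₀ hδ (h θ x hx)
  induction n with
  | zero => exact h0
  | succ n ih =>
    obtain ⟨-, F', hF', hd⟩ := hF (n + 1)
    refine ⟨h0, _, ((ih.mul ih).mul hF').const_mul (a := fun _ => -1) (C := 1) (by simp),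
      fun θ x hx => ?_⟩
    have hne : F θ (x + (0 : ℝ) • v θ) ≠ 0 := by
      simpa using (hδ.trans_le (h θ x hx)).ne'
    have := HasDerivAt.inv (hd θ x hx) hne
    simp only [zero_smul, add_zero] at this
    have heq : -1 * ((F θ x)⁻¹ * (F θ x)⁻¹ * F' θ x) = -F' θ x / F θ x ^ 2 := by
      rw [div_eq_mul_inv, ← inv_pow]; ring
    rw [heq]
    exact this

end UnifSmooth

/-! ### Repeated integration by parts -/

open MeasureTheory in
/-- Non-stationary phase along one direction. If `W * ∂e = τ e` for an oscillating factor `e` of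
modulus at most one, then each integration by parts against `e` gains a factor `τ⁻¹` and
replaces the amplitude `f` by `-∂(f W)`, which is one degree less smooth. -/
theorem norm_integral_mul_le_of_unifSmooth [FiniteDimensional ℝ E] [MeasurableSpace E]
    [BorelSpace E] (μ : Measure E) [μ.IsAddHaarMeasure] {S : Set E} (hU : IsOpen U)
    (hS : IsCompact S) (hSU : S ⊆ U) {τ : Θ → ℝ} (hτ : ∀ θ, 0 < τ θ) {W e e' : Θ → E → ℂ}
    (hW : ∀ n, UnifSmooth v U n W) (he : ∀ θ, ContinuousOn (e θ) U)
    (he' : ∀ θ, ContinuousOn (e' θ) U) (he1 : ∀ θ, ∀ x ∈ U, ‖e θ x‖ ≤ 1)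
    (hd : ∀ θ, ∀ x ∈ U, HasLineDerivAt ℝ (e θ) (e' θ x) x (v θ))
    (hWe : ∀ θ, ∀ x ∈ U, W θ x * e' θ x = τ θ * e θ x) (n : ℕ) {f : Θ → E → ℂ}
    (hf : UnifSmooth v U n f) (hfS : ∀ θ, ∀ x ∉ S, f θ x = 0) :
    ∃ C, ∀ θ, ‖∫ x, f θ x * e θ x ∂μ‖ ≤ C * (τ θ)⁻¹ ^ n := by
  have hint : ∀ {g : E → ℂ}, ContinuousOn g U → (∀ x ∉ S, g x = 0) → Integrable g μ := by
    intro g hg hgS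
    rw [← integrableOn_iff_integrable_of_support_subset (s := S)
      (fun x hx => by_contra fun h => hx (hgS x h))]
    exact (hg.mono hSU).integrableOn_compact hS
  induction n generalizing f with
  | zero =>
    obtain ⟨⟨C, hC⟩, -⟩ := hf
    refine ⟨C * μ.real S, fun θ => ?_⟩
    rw [pow_zero, mul_one, ← setIntegral_eq_integral_of_forall_compl_eq_zero (s := S)
      (fun x hx => by rw [hfS θ x hx, zero_mul])]
    refine norm_setIntegral_le_of_norm_le_const hS.measure_lt_top fun x hx => ?_
    rw [norm_mul]
    calc ‖f θ x‖ * ‖e θ x‖ ≤ C * 1 := by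
          gcongr
          · exact (norm_nonneg _).trans (hC θ x (hSU hx))
          · exact hC θ x (hSU hx)
          · exact he1 θ x (hSU hx)
      _ = C := mul_one C
  | succ n ih =>
    obtain ⟨⟨-, hgc⟩, g', hg', hgd⟩ := hf.mul (hW (n + 1))
    -- Outside `U` the existentially given derivative is replaced by zero.
    have hg'' : UnifSmooth v U n (fun θ => U.indicator (g' θ)) :=
      hg'.congr hU fun θ x hx => Set.indicator_of_mem hx _
    have hzero : ∀ θ, ∀ x ∉ S, U.indicator (g' θ) x = 0 := by
      intro θ x hx
      by_cases hxU : x ∈ U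
      · rw [Set.indicator_of_mem hxU]
        refine (hgd θ x hxU).unique ?_
        refine HasLineDerivAt.congr_of_eventuallyEq (f := fun _ => (0 : ℂ))
          (hasDerivAt_const (0 : ℝ) (0 : ℂ)) ?_
        filter_upwards [hS.isClosed.isOpen_compl.mem_nhds hx] with y hy
        rw [hfS θ y hy, zero_mul]
      · exact Set.indicator_of_notMem hxU _
    obtain ⟨C, hC⟩ := ih hg'' hzero
    refine ⟨C, fun θ => ?_⟩
    have hgS : ∀ x ∉ S, f θ x * W θ x = 0 := fun x hx => by rw [hfS θ x hx, zero_mul]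
    have hts : tsupport (fun x => f θ x * W θ x) ⊆ S :=
      closure_minimal (fun x hx => by_contra fun h => hx (hgS x h)) hS.isClosed
    have hderiv : ∀ x, HasLineDerivAt ℝ (fun x => f θ x * W θ x) (U.indicator (g' θ) x) x
        (v θ) := by
      intro x
      by_cases hxU : x ∈ U
      · rw [Set.indicator_of_mem hxU]; exact hgd θ x hxU
      · rw [Set.indicator_of_notMem hxU]
        refine HasLineDerivAt.congr_of_eventuallyEq (f := fun _ => (0 : ℂ))
          (hasDerivAt_const (0 : ℝ) (0 : ℂ)) ?_
        filter_upwards [hS.isClosed.isOpen_compl.mem_nhds fun h => hxU (hSU h)] with y hy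
        exact hgS y hy
    have hparts := integral_bilinear_hasLineDerivAt_right_eq_neg_left_of_integrable (μ := μ)
      (f := e θ) (f' := e' θ) (g := fun x => f θ x * W θ x) (g' := U.indicator (g' θ)) (v := v θ)
      (B := ContinuousLinearMap.mul ℝ ℂ)
      (hint ((he' θ).mul (hgc θ)) fun x hx => by simp [hfS θ x hx])
      (hint ((he θ).mul (hg''.base.2 θ)) fun x hx => by simp [hzero θ x hx])
      (hint ((he θ).mul (hgc θ)) fun x hx => by simp [hfS θ x hx])
      (fun x hx => hd θ x (hSU (hts hx))) (fun x _ => hderiv x)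
    simp only [ContinuousLinearMap.mul_apply'] at hparts
    have hmain : (τ θ : ℂ) * ∫ x, f θ x * e θ x ∂μ
        = -∫ x, U.indicator (g' θ) x * e θ x ∂μ := by
      rw [← integral_const_mul]
      calc ∫ x, (τ θ : ℂ) * (f θ x * e θ x) ∂μ = ∫ x, e' θ x * (f θ x * W θ x) ∂μ := by
            congr 1 with x
            by_cases hx : x ∈ S
            · linear_combination -f θ x * hWe θ x (hSU hx)
            · simp [hfS θ x hx]
        _ = -∫ x, e θ x * U.indicator (g' θ) x ∂μ := by rw [hparts, neg_neg]
        _ = _ := by simp only [mul_comm]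
    have hnorm : τ θ * ‖∫ x, f θ x * e θ x ∂μ‖ ≤ C * (τ θ)⁻¹ ^ n := by
      have := congrArg norm hmain
      rw [norm_mul, norm_neg, Complex.norm_real, Real.norm_of_nonneg (hτ θ).le] at this
      rw [this]; exact hC θ
    rw [pow_succ, ← mul_assoc, ← div_eq_mul_inv, le_div_iff₀ (hτ θ), mul_comm]
    exact hnorm

end UnifSmooth

namespace SL3Flat

/-! ### Exponential weights on `𝔞` -/

lemma abs_coord_le (H : lieA) (j : Fin 3) : |H.1 j j| ≤ ‖H‖ := by
  rw [norm_lieA, ← Real.sqrt_sq_eq_abs]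
  refine Real.sqrt_le_sqrt ?_
  refine (Finset.single_le_sum (f := fun l => H.1 j l ^ 2) (fun _ _ => sq_nonneg _)
    (Finset.mem_univ j)).trans ?_
  exact Finset.single_le_sum (f := fun i => ∑ l, H.1 i l ^ 2)
    (fun _ _ => Finset.sum_nonneg fun _ _ => sq_nonneg _) (Finset.mem_univ j)

lemma continuous_coord (j : Fin 3) : Continuous fun H : lieA => H.1 j j := by
  let L : lieA →ₗ[ℝ] ℝ :=
    { toFun := fun H => H.1 j j
      map_add' := fun _ _ => rfl
      map_smul' := fun _ _ => rfl }
  exact L.continuous_of_finiteDimensional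

lemma sum_coord (H : lieA) : H.1 0 0 + H.1 1 1 + H.1 2 2 = 0 := by
  rw [← Fin.sum_univ_three (fun i => H.1 i i)]; exact H.2.2

lemma hasLineDerivAt_of_eq {E F : Type*} [NormedAddCommGroup E] [NormedSpace ℝ E]
    [NormedAddCommGroup F] [NormedSpace ℝ F] {f : E → F} {f₁ f' : F} {x v : E}
    (h : HasLineDerivAt ℝ f f₁ x v) (e : f₁ = f') : HasLineDerivAt ℝ f f' x v := e ▸ h

/-- The partition function `∑ⱼ wⱼ exp(s Hⱼⱼ)` of the weights `w`. -/
noncomputable def expSum (w : Fin 3 → ℝ) (s : ℝ) (H : lieA) : ℝ := ∑ j, w j * Real.exp (s * H.1 j j)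

/-- The Gibbs probability vector on `{0, 1, 2}` proportional to `wⱼ exp(s Hⱼⱼ)`. -/
noncomputable def gibbs (w : Fin 3 → ℝ) (s : ℝ) (H : lieA) (j : Fin 3) : ℝ :=
  w j * Real.exp (s * H.1 j j) / expSum w s H

/-- The mean of the coordinates of `v` for the Gibbs probability vector. -/
noncomputable def gibbsMean (w : Fin 3 → ℝ) (s : ℝ) (H v : lieA) : ℝ := ∑ j, gibbs w s H j * v.1 j j

section Gibbs

variable {w : Fin 3 → ℝ} {s : ℝ}

lemma expSum_pos (hw : ∀ j, 0 ≤ w j) (hw' : 0 < ∑ j, w j) (H : lieA) : 0 < expSum w s H := by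
  obtain ⟨j, -, hj⟩ : ∃ j ∈ Finset.univ, 0 < w j := by
    by_contra! h
    exact hw'.not_ge (Finset.sum_nonpos h)
  exact Finset.sum_pos' (fun i _ => mul_nonneg (hw i) (Real.exp_pos _).le)
    ⟨j, Finset.mem_univ j, mul_pos hj (Real.exp_pos _)⟩

lemma gibbs_nonneg (hw : ∀ j, 0 ≤ w j) (hw' : 0 < ∑ j, w j) (H : lieA) (j : Fin 3) :
    0 ≤ gibbs w s H j :=
  div_nonneg (mul_nonneg (hw j) (Real.exp_pos _).le) (expSum_pos hw hw' H).le

lemma sum_gibbs (hw : ∀ j, 0 ≤ w j) (hw' : 0 < ∑ j, w j) (H : lieA) :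
    gibbs w s H 0 + gibbs w s H 1 + gibbs w s H 2 = 1 := by
  rw [← Fin.sum_univ_three (fun j => gibbs w s H j)]
  simp only [gibbs]
  rw [← Finset.sum_div]
  exact div_self (expSum_pos hw hw' H).ne'

lemma gibbs_le_one (hw : ∀ j, 0 ≤ w j) (hw' : 0 < ∑ j, w j) (H : lieA) (j : Fin 3) :
    gibbs w s H j ≤ 1 := by
  have h := sum_gibbs (s := s) hw hw' H
  have h0 := gibbs_nonneg (s := s) hw hw' H
  have := h0 0; have := h0 1; have := h0 2
  fin_cases j <;> simp only [Fin.zero_eta, Fin.mk_one, Fin.reduceFinMk] <;> linarith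

lemma gibbs_le_exp_mul (hw : ∀ j, 0 ≤ w j) (hw' : 0 < ∑ j, w j) {r : ℝ} {H H' : lieA}
    (h : ∀ j, |s * H.1 j j - s * H'.1 j j| ≤ r) (j : Fin 3) :
    gibbs w s H j ≤ Real.exp (2 * r) * gibbs w s H' j := by
  have hnum : w j * Real.exp (s * H.1 j j) ≤ Real.exp r * (w j * Real.exp (s * H'.1 j j)) := by
    rw [mul_left_comm, ← Real.exp_add]
    refine mul_le_mul_of_nonneg_left (Real.exp_le_exp.2 ?_) (hw j)
    linarith [(abs_le.1 (h j)).2]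
  have hden : expSum w s H' ≤ Real.exp r * expSum w s H := by
    rw [expSum, expSum, Finset.mul_sum]
    refine Finset.sum_le_sum fun i _ => ?_
    rw [mul_left_comm, ← Real.exp_add]
    refine mul_le_mul_of_nonneg_left (Real.exp_le_exp.2 ?_) (hw i)
    linarith [(abs_le.1 (h i)).1]
  have h1 := expSum_pos (s := s) hw hw' H
  have h2 := expSum_pos (s := s) hw hw' H'
  rw [gibbs, gibbs, div_le_iff₀ h1, two_mul, Real.exp_add]
  calc w j * Real.exp (s * H.1 j j) ≤ Real.exp r * (w j * Real.exp (s * H'.1 j j)) := hnum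
    _ = Real.exp r * (w j * Real.exp (s * H'.1 j j)) / expSum w s H' * expSum w s H' := by
        field_simp
    _ ≤ Real.exp r * (w j * Real.exp (s * H'.1 j j)) / expSum w s H'
          * (Real.exp r * expSum w s H) := by
        refine mul_le_mul_of_nonneg_left hden (div_nonneg ?_ h2.le)
        exact mul_nonneg (Real.exp_pos _).le (mul_nonneg (hw j) (Real.exp_pos _).le)
    _ = _ := by ring

lemma continuous_expSum : Continuous (expSum w s) :=
  continuous_finsetSum _ fun j _ =>
    continuous_const.mul (Real.continuous_exp.comp (continuous_const.mul (continuous_coord j)))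

lemma continuous_gibbs (hw : ∀ j, 0 ≤ w j) (hw' : 0 < ∑ j, w j) (j : Fin 3) :
    Continuous fun H => gibbs w s H j :=
  (continuous_const.mul (Real.continuous_exp.comp
    (continuous_const.mul (continuous_coord j)))).div continuous_expSum
    fun H => (expSum_pos hw hw' H).ne'

lemma hasLineDerivAt_weight (H v : lieA) (j : Fin 3) :
    HasLineDerivAt ℝ (fun H : lieA => w j * Real.exp (s * H.1 j j))
      (s * v.1 j j * (w j * Real.exp (s * H.1 j j))) H v := by
  have h1 : HasDerivAt (fun t : ℝ => s * (H.1 j j + t * v.1 j j)) (s * v.1 j j) 0 := by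
    simpa using (((hasDerivAt_id (0 : ℝ)).mul_const (v.1 j j)).const_add (H.1 j j)).const_mul s
  have h2 := (h1.exp).const_mul (w j)
  have h3 : s * v.1 j j * (w j * Real.exp (s * H.1 j j))
      = w j * (Real.exp (s * (H.1 j j + 0 * v.1 j j)) * (s * v.1 j j)) := by
    rw [zero_mul, add_zero]; ring
  rw [h3]
  exact h2

lemma hasLineDerivAt_expSum (hw : ∀ j, 0 ≤ w j) (hw' : 0 < ∑ j, w j) (H v : lieA) :
    HasLineDerivAt ℝ (expSum w s) (s * gibbsMean w s H v * expSum w s H) H v := by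
  have h1 : s * gibbsMean w s H v * expSum w s H
      = ∑ j, s * v.1 j j * (w j * Real.exp (s * H.1 j j)) := by
    rw [gibbsMean, mul_assoc, Finset.sum_mul, Finset.mul_sum]
    refine Finset.sum_congr rfl fun j _ => ?_
    have := (expSum_pos (s := s) hw hw' H).ne'
    rw [gibbs]; field_simp
  rw [h1]
  exact HasDerivAt.fun_sum fun j _ => hasLineDerivAt_weight H v j

lemma hasLineDerivAt_log_expSum (hw : ∀ j, 0 ≤ w j) (hw' : 0 < ∑ j, w j) (H v : lieA) :
    HasLineDerivAt ℝ (fun H => Real.log (expSum w s H)) (s * gibbsMean w s H v) H v := by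
  have hpos := expSum_pos (s := s) hw hw' H
  have hne : expSum w s (H + (0 : ℝ) • v) ≠ 0 := by rw [zero_smul, add_zero]; exact hpos.ne'
  have h := HasDerivAt.log (hasLineDerivAt_expSum (s := s) hw hw' H v) hne
  rw [zero_smul, add_zero, mul_div_assoc, div_self hpos.ne', mul_one] at h
  exact h

lemma hasLineDerivAt_gibbs (hw : ∀ j, 0 ≤ w j) (hw' : 0 < ∑ j, w j) (H v : lieA) (j : Fin 3) :
    HasLineDerivAt ℝ (fun H => gibbs w s H j)
      (s * (v.1 j j - gibbsMean w s H v) * gibbs w s H j) H v := by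
  have hpos := expSum_pos (s := s) hw hw' H
  have hne : expSum w s (H + (0 : ℝ) • v) ≠ 0 := by rw [zero_smul, add_zero]; exact hpos.ne'
  have h := HasDerivAt.div (hasLineDerivAt_weight (w := w) (s := s) H v j)
    (hasLineDerivAt_expSum (s := s) hw hw' H v) hne
  simp only [zero_smul, add_zero] at h
  have h3 : s * (v.1 j j - gibbsMean w s H v) * gibbs w s H j
      = (s * v.1 j j * (w j * Real.exp (s * H.1 j j)) * expSum w s H
        - w j * Real.exp (s * H.1 j j) * (s * gibbsMean w s H v * expSum w s H))
          / expSum w s H ^ 2 := by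
    have := hpos.ne'
    rw [gibbs]; field_simp
  rw [h3]
  exact h

/-- The derivative of the mean is a variance, which only involves products of distinct Gibbs
probabilities. -/
lemma hasLineDerivAt_gibbsMean (hw : ∀ j, 0 ≤ w j) (hw' : 0 < ∑ j, w j) (H v : lieA) :
    HasLineDerivAt ℝ (fun H => gibbsMean w s H v)
      (s * ((v.1 0 0 - v.1 1 1) ^ 2 * (gibbs w s H 0 * gibbs w s H 1)
        + (v.1 0 0 - v.1 2 2) ^ 2 * (gibbs w s H 0 * gibbs w s H 2)
        + (v.1 1 1 - v.1 2 2) ^ 2 * (gibbs w s H 1 * gibbs w s H 2))) H v := by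
  have h : HasLineDerivAt ℝ (fun H => gibbsMean w s H v)
      (∑ j, s * (v.1 j j - gibbsMean w s H v) * gibbs w s H j * v.1 j j) H v :=
    HasDerivAt.fun_sum fun j _ => HasDerivAt.mul_const (hasLineDerivAt_gibbs hw hw' H v j) _
  refine hasLineDerivAt_of_eq h ?_
  have h1 := sum_gibbs (s := s) hw hw' H
  simp only [gibbsMean, Fin.sum_univ_three]
  obtain ⟨x, hx⟩ : ∃ x, x = gibbs w s H 0 := ⟨_, rfl⟩
  have h2 : gibbs w s H 2 = 1 - x - gibbs w s H 1 := by rw [hx]; linarith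
  rw [h2, ← hx]
  ring

end Gibbs

/-! ### Uniform smoothness of the Gibbs families -/

section Families

variable {Θ : Type*} {v : Θ → lieA} {U : Set lieA} {w : Θ → Fin 3 → ℝ} {V : ℝ}

lemma unifSmooth_gibbs (hw : ∀ θ j, 0 ≤ w θ j) (hw' : ∀ θ, 0 < ∑ j, w θ j)
    (hv : ∀ θ j, |(v θ).1 j j| ≤ V) (s : ℝ) (n : ℕ) (j : Fin 3) :
    UnifSmooth v U n (fun θ H => gibbs (w θ) s H j) := by
  have base : ∀ j, UnifSmooth v U 0 (fun θ H => gibbs (w θ) s H j) := fun j =>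
    ⟨⟨1, fun θ H _ => by
      rw [Real.norm_of_nonneg (gibbs_nonneg (hw θ) (hw' θ) H j)]
      exact gibbs_le_one (hw θ) (hw' θ) H j⟩,
    fun θ => (continuous_gibbs (hw θ) (hw' θ) j).continuousOn⟩
  induction n generalizing j with
  | zero => exact base j
  | succ n ih =>
    have hmean : UnifSmooth v U n (fun θ H => ∑ i, (v θ).1 i i * gibbs (w θ) s H i) :=
      .sum _ fun i _ => (ih i).const_mul (fun θ => hv θ i)
    have hlin : UnifSmooth v U n (fun θ H => s * ((v θ).1 j j
        + -1 * ∑ i, (v θ).1 i i * gibbs (w θ) s H i)) :=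
      ((UnifSmooth.const (fun θ => hv θ j) n).add
        (hmean.const_mul (a := fun _ => -1) (C := 1) (by simp))).const_mul
        (a := fun _ => s) (C := |s|) (by simp)
    refine ⟨base j, _, hlin.mul (ih j), fun θ H _ => ?_⟩
    refine hasLineDerivAt_of_eq (hasLineDerivAt_gibbs (s := s) (hw θ) (hw' θ) H (v θ) j) ?_
    simp only [gibbsMean, Fin.sum_univ_three]
    ring

lemma unifSmooth_gibbsMean (hw : ∀ θ j, 0 ≤ w θ j) (hw' : ∀ θ, 0 < ∑ j, w θ j)
    (hv : ∀ θ j, |(v θ).1 j j| ≤ V) (s : ℝ) (n : ℕ) :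
    UnifSmooth v U n (fun θ H => gibbsMean (w θ) s H (v θ)) := by
  have : UnifSmooth v U n (fun θ H => ∑ i, (v θ).1 i i * gibbs (w θ) s H i) :=
    .sum _ fun i _ => (unifSmooth_gibbs hw hw' hv s n i).const_mul (fun θ => hv θ i)
  simpa only [gibbsMean, mul_comm] using this

/-- Products of distinct Gibbs probabilities remain uniformly smooth after division by any scale
`D θ` that dominates them, because the logarithmic derivative of such a product is a smooth
function of the probabilities. -/
lemma unifSmooth_gibbs_mul_gibbs_div (hw : ∀ θ j, 0 ≤ w θ j) (hw' : ∀ θ, 0 < ∑ j, w θ j)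
    (hv : ∀ θ j, |(v θ).1 j j| ≤ V) {s B : ℝ} {D : Θ → ℝ} (hD : ∀ θ, 0 < D θ) {i j : Fin 3}
    (hB : ∀ θ, ∀ H ∈ U, gibbs (w θ) s H i * gibbs (w θ) s H j ≤ B * D θ) (n : ℕ) :
    UnifSmooth v U n (fun θ H => gibbs (w θ) s H i * gibbs (w θ) s H j / D θ) := by
  have hG : ∀ n, UnifSmooth v U n (fun θ H => s * (((v θ).1 i i + (v θ).1 j j)
      + -2 * gibbsMean (w θ) s H (v θ))) := fun n =>
    (((UnifSmooth.const (fun θ => hv θ i) n).add (UnifSmooth.const (fun θ => hv θ j) n)).add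
      ((unifSmooth_gibbsMean hw hw' hv s n).const_mul (a := fun _ => -2) (C := 2)
        (by simp))).const_mul (a := fun _ => s) (C := |s|) (by simp)
  refine UnifSmooth.of_hasLineDerivAt_mul_self ⟨⟨B, fun θ H hH => ?_⟩, fun θ => ?_⟩
    (fun θ H _ => ?_) hG n
  · rw [Real.norm_of_nonneg (div_nonneg (mul_nonneg (gibbs_nonneg (hw θ) (hw' θ) H i)
      (gibbs_nonneg (hw θ) (hw' θ) H j)) (hD θ).le), div_le_iff₀ (hD θ)]
    exact hB θ H hH
  · exact (((continuous_gibbs (hw θ) (hw' θ) i).mul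
      (continuous_gibbs (hw θ) (hw' θ) j)).div_const _).continuousOn
  · have h := HasDerivAt.div_const (HasDerivAt.mul
      (hasLineDerivAt_gibbs (s := s) (hw θ) (hw' θ) H (v θ) i)
      (hasLineDerivAt_gibbs (s := s) (hw θ) (hw' θ) H (v θ) j)) (D θ)
    simp only [zero_smul, add_zero] at h
    refine hasLineDerivAt_of_eq h ?_
    ring

end Families

/-! ### Decay of the oscillatory integral in terms of the scale of the phase -/

/-- The phase `-λ(H) + ν(A(h exp H))`, where `p` and `q` are the squared entries of the first
column of `h⁻¹` and of the last row of `h`, and `ν(X) = a X₀₀ + c X₂₂`. -/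
noncomputable def gibbsPhase (lam : StrongDual ℝ lieA) (a c : ℝ) (p q : Fin 3 → ℝ) (H : lieA) : ℝ :=
  -lam H + (a * (-(1 / 2) * Real.log (expSum p (-2) H)) + c * (1 / 2 * Real.log (expSum q 2 H)))

/-- Minus the derivative of `gibbsPhase` in the direction `v`. -/
noncomputable def gibbsSlope (lam : StrongDual ℝ lieA) (a c : ℝ) (p q : Fin 3 → ℝ) (v H : lieA) : ℝ :=
  lam v - a * gibbsMean p (-2) H v - c * gibbsMean q 2 H v

lemma hasLineDerivAt_gibbsPhase (lam : StrongDual ℝ lieA) (a c : ℝ) {p q : Fin 3 → ℝ}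
    (hp : ∀ j, 0 ≤ p j) (hp' : 0 < ∑ j, p j) (hq : ∀ j, 0 ≤ q j) (hq' : 0 < ∑ j, q j)
    (H v : lieA) :
    HasLineDerivAt ℝ (gibbsPhase lam a c p q) (-gibbsSlope lam a c p q v H) H v := by
  have h1 : HasLineDerivAt ℝ lam (lam v) H v := lam.hasFDerivAt.hasLineDerivAt v
  have h := HasDerivAt.add (HasDerivAt.neg h1) (HasDerivAt.add
    (HasDerivAt.const_mul a (HasDerivAt.const_mul (-(1 / 2))
      (hasLineDerivAt_log_expSum (s := -2) hp hp' H v)))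
    (HasDerivAt.const_mul c (HasDerivAt.const_mul (1 / 2)
      (hasLineDerivAt_log_expSum (s := 2) hq hq' H v))))
  refine hasLineDerivAt_of_eq h ?_
  rw [gibbsSlope]; ring

lemma continuous_gibbsPhase (lam : StrongDual ℝ lieA) (a c : ℝ) {p q : Fin 3 → ℝ}
    (hp : ∀ j, 0 ≤ p j) (hp' : 0 < ∑ j, p j) (hq : ∀ j, 0 ≤ q j) (hq' : 0 < ∑ j, q j) :
    Continuous (gibbsPhase lam a c p q) :=
  lam.continuous.neg.add ((continuous_const.mul (continuous_const.mul
    (continuous_expSum.log fun H => (expSum_pos hp hp' H).ne'))).add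
    (continuous_const.mul (continuous_const.mul
    (continuous_expSum.log fun H => (expSum_pos hq hq' H).ne'))))

open MeasureTheory in
/-- If on `U` the slope of the phase is comparable to a scale `D θ` which also dominates the
products of distinct Gibbs probabilities, then the phase divided by `D θ` is uniformly smooth and
non-stationary, and the oscillatory integral decays like any power of `(t θ * D θ)⁻¹`. -/
theorem norm_integral_gibbsPhase_le (μ : Measure lieA) [μ.IsAddHaarMeasure] {Θ : Type*}
    {U S : Set lieA} (hU : IsOpen U) (hS : IsCompact S) (hSU : S ⊆ U)
    {v : Θ → lieA} {lam : Θ → StrongDual ℝ lieA} {a c t D : Θ → ℝ} {p q : Θ → Fin 3 → ℝ} {B κ : ℝ}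
    (hv : ∀ θ, ‖v θ‖ ≤ B) (ha : ∀ θ, |a θ| ≤ B) (hc : ∀ θ, |c θ| ≤ B)
    (ht : ∀ θ, 0 < t θ) (hD : ∀ θ, 0 < D θ)
    (hp : ∀ θ j, 0 ≤ p θ j) (hp' : ∀ θ, 0 < ∑ j, p θ j)
    (hq : ∀ θ j, 0 ≤ q θ j) (hq' : ∀ θ, 0 < ∑ j, q θ j)
    (hpB : ∀ θ, ∀ H ∈ U, ∀ i j, i ≠ j →
      gibbs (p θ) (-2) H i * gibbs (p θ) (-2) H j ≤ B * D θ)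
    (hqB : ∀ θ, ∀ H ∈ U, ∀ i j, i ≠ j → gibbs (q θ) 2 H i * gibbs (q θ) 2 H j ≤ B * D θ)
    (hκ : 0 < κ)
    (hlow : ∀ θ, ∀ H ∈ U, κ * D θ ≤ gibbsSlope (lam θ) (a θ) (c θ) (p θ) (q θ) (v θ) H)
    (hupp : ∀ θ, ∀ H ∈ U, gibbsSlope (lam θ) (a θ) (c θ) (p θ) (q θ) (v θ) H ≤ B * D θ)
    {n : ℕ} {f : Θ → lieA → ℂ} (hf : UnifSmooth v U n f) (hfS : ∀ θ, ∀ H ∉ S, f θ H = 0) :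
    ∃ C, ∀ θ, ‖∫ H, f θ H * Complex.exp
      (Complex.I * t θ * (gibbsPhase (lam θ) (a θ) (c θ) (p θ) (q θ) H : ℝ)) ∂μ‖
        ≤ C * (t θ * D θ)⁻¹ ^ n := by
  have hvj : ∀ θ j, |(v θ).1 j j| ≤ B := fun θ j => (abs_coord_le _ _).trans (hv θ)
  -- The slope divided by its scale.
  let P : Θ → lieA → ℝ := fun θ H =>
    gibbsSlope (lam θ) (a θ) (c θ) (p θ) (q θ) (v θ) H / D θ
  have hcont : ∀ θ, Continuous
      (fun H => gibbsSlope (lam θ) (a θ) (c θ) (p θ) (q θ) (v θ) H) := by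
    intro θ
    refine (continuous_const.sub (continuous_const.mul ?_)).sub (continuous_const.mul ?_)
    · exact continuous_finsetSum _ fun j _ =>
        (continuous_gibbs (hp θ) (hp' θ) j).mul continuous_const
    · exact continuous_finsetSum _ fun j _ =>
        (continuous_gibbs (hq θ) (hq' θ) j).mul continuous_const
  have hPlow : ∀ θ, ∀ H ∈ U, κ ≤ P θ H := fun θ H hH => by
    rw [le_div_iff₀ (hD θ)]; exact hlow θ H hH
  have hP0 : UnifSmooth v U 0 P := by
    refine ⟨⟨B, fun θ H hH => ?_⟩, fun θ => ((hcont θ).div_const _).continuousOn⟩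
    rw [Real.norm_of_nonneg (hκ.le.trans (hPlow θ H hH)), div_le_iff₀ (hD θ)]
    exact hupp θ H hH
  have hP : ∀ n, UnifSmooth v U n P := by
    intro n
    cases n with
    | zero => exact hP0
    | succ n =>
      have hsq : ∀ i j : Fin 3, ∀ θ, ‖((v θ).1 i i - (v θ).1 j j) ^ 2‖ ≤ (2 * B) ^ 2 := by
        intro i j θ
        rw [norm_pow, Real.norm_eq_abs]
        have := abs_sub ((v θ).1 i i) ((v θ).1 j j)
        have := hvj θ i
        have := hvj θ j
        gcongr
        linarith
      have hvar : ∀ {w : Θ → Fin 3 → ℝ} {s : ℝ} (_ : ∀ θ j, 0 ≤ w θ j)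
          (_ : ∀ θ, 0 < ∑ j, w θ j)
          (_ : ∀ θ, ∀ H ∈ U, ∀ i j, i ≠ j → gibbs (w θ) s H i * gibbs (w θ) s H j ≤ B * D θ),
          UnifSmooth v U n (fun θ H =>
            ((v θ).1 0 0 - (v θ).1 1 1) ^ 2 * (gibbs (w θ) s H 0 * gibbs (w θ) s H 1 / D θ)
            + ((v θ).1 0 0 - (v θ).1 2 2) ^ 2 * (gibbs (w θ) s H 0 * gibbs (w θ) s H 2 / D θ)
            + ((v θ).1 1 1 - (v θ).1 2 2) ^ 2
              * (gibbs (w θ) s H 1 * gibbs (w θ) s H 2 / D θ)) := by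
        intro w s hw hw' hB
        exact (((unifSmooth_gibbs_mul_gibbs_div hw hw' hvj hD
            (fun θ H hH => hB θ H hH 0 1 (by decide)) n).const_mul (hsq 0 1)).add
          ((unifSmooth_gibbs_mul_gibbs_div hw hw' hvj hD
            (fun θ H hH => hB θ H hH 0 2 (by decide)) n).const_mul (hsq 0 2))).add
          ((unifSmooth_gibbs_mul_gibbs_div hw hw' hvj hD
            (fun θ H hH => hB θ H hH 1 2 (by decide)) n).const_mul (hsq 1 2))
      have h1 := ((hvar hp hp' hpB).const_mul ha).const_mul (a := fun _ => 2) (C := 2) (by simp)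
      have h2 := ((hvar hq hq' hqB).const_mul hc).const_mul (a := fun _ => -2) (C := 2) (by simp)
      refine ⟨hP0, _, h1.add h2, fun θ H _ => ?_⟩
      have h := HasDerivAt.div_const (HasDerivAt.sub (HasDerivAt.sub
        (hasDerivAt_const (0 : ℝ) (lam θ (v θ)))
        (HasDerivAt.const_mul (a θ) (hasLineDerivAt_gibbsMean (s := -2) (hp θ) (hp' θ) H (v θ))))
        (HasDerivAt.const_mul (c θ) (hasLineDerivAt_gibbsMean (s := 2) (hq θ) (hq' θ) H (v θ))))
        (D θ)
      refine hasLineDerivAt_of_eq h ?_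
      ring
  have hW : ∀ n, UnifSmooth v U n (fun θ H => Complex.I * ((P θ H)⁻¹ : ℝ)) := fun n =>
    (UnifSmooth.inv hP hκ hPlow n).ofReal.const_mul (a := fun _ => Complex.I) (C := 1) (by simp)
  have hph := fun θ => continuous_gibbsPhase (lam θ) (a θ) (c θ) (hp θ) (hp' θ) (hq θ) (hq' θ)
  have hcexp : ∀ θ, Continuous fun H => Complex.exp
      (Complex.I * t θ * (gibbsPhase (lam θ) (a θ) (c θ) (p θ) (q θ) H : ℝ)) := fun θ =>
    Complex.continuous_exp.comp (continuous_const.mul (Complex.continuous_ofReal.comp (hph θ)))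
  refine norm_integral_mul_le_of_unifSmooth μ hU hS hSU (τ := fun θ => t θ * D θ)
    (fun θ => mul_pos (ht θ) (hD θ)) hW (fun θ => (hcexp θ).continuousOn)
    (e' := fun θ H => Complex.exp
      (Complex.I * t θ * (gibbsPhase (lam θ) (a θ) (c θ) (p θ) (q θ) H : ℝ))
      * (Complex.I * t θ * (-gibbsSlope (lam θ) (a θ) (c θ) (p θ) (q θ) (v θ) H : ℝ)))
    (fun θ => ((hcexp θ).mul (continuous_const.mul
      (Complex.continuous_ofReal.comp (hcont θ).neg))).continuousOn)
    (fun θ H _ => ?_) (fun θ H _ => ?_) (fun θ H hH => ?_) n hf hfS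
  · rw [mul_assoc, ← Complex.ofReal_mul, mul_comm, Complex.norm_exp_ofReal_mul_I]
  · have h1 := HasDerivAt.ofReal_comp
      (hasLineDerivAt_gibbsPhase (lam θ) (a θ) (c θ) (hp θ) (hp' θ) (hq θ) (hq' θ) H (v θ))
    have h2 := (h1.const_mul (Complex.I * t θ)).cexp
    simp only [zero_smul, add_zero] at h2
    exact h2
  · have hslope : gibbsSlope (lam θ) (a θ) (c θ) (p θ) (q θ) (v θ) H = D θ * P θ H := by
      simp only [P]; field_simp [(hD θ).ne']
    have hPne : (P θ H : ℂ) ≠ 0 := by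
      exact_mod_cast (hκ.trans_le (hPlow θ H hH)).ne'
    rw [hslope]
    push_cast
    field_simp
    rw [Complex.I_sq]
    ring

/-! ### The Iwasawa projection along a flat -/

lemma K_row_mul_row {k : G} (hk : k ∈ K) (i j : Fin 3) :
    k.1 i 0 * k.1 j 0 + k.1 i 1 * k.1 j 1 + k.1 i 2 * k.1 j 2 = if i = j then 1 else 0 := by
  have h : k.1 * k.1ᵀ = 1 := hk
  have := congrFun (congrFun h i) j
  rw [Matrix.mul_apply, Fin.sum_univ_three, Matrix.one_apply] at this
  exact this

lemma coe_inv_of_mem_K {k : G} (hk : k ∈ K) : (k⁻¹).1 = k.1ᵀ := by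
  have h : k.1 * k.1ᵀ = 1 := hk
  have h1 : (k⁻¹).1 * k.1 = 1 := by
    rw [← Matrix.SpecialLinearGroup.coe_mul, inv_mul_cancel, Matrix.SpecialLinearGroup.coe_one]
  calc (k⁻¹).1 = (k⁻¹).1 * (k.1 * k.1ᵀ) := by rw [h, Matrix.mul_one]
    _ = k.1ᵀ := by rw [← Matrix.mul_assoc, h1, Matrix.one_mul]

lemma K_col_mul_col {k : G} (hk : k ∈ K) (i j : Fin 3) :
    k.1 0 i * k.1 0 j + k.1 1 i * k.1 1 j + k.1 2 i * k.1 2 j = if i = j then 1 else 0 := by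
  have h : k.1ᵀ * k.1 = 1 := mul_eq_one_comm.1 (show k.1 * k.1ᵀ = 1 from hk)
  have := congrFun (congrFun h i) j
  rw [Matrix.mul_apply, Fin.sum_univ_three, Matrix.one_apply] at this
  exact this

lemma coe_expA (H : lieA) : (expA H).1 = Matrix.diagonal (fun i => Real.exp (H.1 i i)) :=
  exp_lieA H

lemma expA_inv (H : lieA) : (expA H)⁻¹ = expA (-H) := by
  rw [inv_eq_iff_mul_eq_one]
  apply Subtype.ext
  rw [Matrix.SpecialLinearGroup.coe_mul, coe_expA, coe_expA, Matrix.diagonal_mul_diagonal,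
    Matrix.SpecialLinearGroup.coe_one, ← Matrix.diagonal_one]
  congr 1
  funext i
  have : (-H).1 i i = -H.1 i i := rfl
  rw [this, ← Real.exp_add, add_neg_cancel, Real.exp_zero]

lemma mul_expA_apply (h : G) (H : lieA) (i j : Fin 3) :
    (h * expA H).1 i j = h.1 i j * Real.exp (H.1 j j) := by
  rw [Matrix.SpecialLinearGroup.coe_mul, coe_expA, Matrix.mul_diagonal]

lemma inv_mul_expA_apply (h : G) (H : lieA) (i j : Fin 3) :
    ((h * expA H)⁻¹).1 i j = Real.exp (-H.1 i i) * (h⁻¹).1 i j := by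
  rw [mul_inv_rev, expA_inv, Matrix.SpecialLinearGroup.coe_mul, coe_expA, Matrix.diagonal_mul]
  rfl

/-- The last row of `n exp(A) k` is `exp(A₂₂)` times the last row of `k`. -/
lemma iwasawaA_two_two (h : G) :
    (iwasawaA h).1 2 2 = 1 / 2 * Real.log (∑ j, h.1 2 j ^ 2) := by
  obtain ⟨n, hn, k, hk, e⟩ := iwasawaA_spec h
  rw [mem_N_iff] at hn
  obtain ⟨-, -, a2, -, a4, a5⟩ := hn
  have hrow : ∀ j, h.1 2 j = Real.exp ((iwasawaA h).1 2 2) * k.1 2 j := by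
    intro j
    conv_lhs => rw [e]
    rw [Matrix.SpecialLinearGroup.coe_mul, Matrix.mul_apply, Fin.sum_univ_three, mul_expA_apply,
      mul_expA_apply, mul_expA_apply, a2, a4, a5]
    ring
  have hs : ∑ j, h.1 2 j ^ 2 = Real.exp ((iwasawaA h).1 2 2) ^ 2 := by
    rw [Fin.sum_univ_three, hrow 0, hrow 1, hrow 2]
    have := K_row_mul_row hk 2 2
    rw [if_pos rfl] at this
    linear_combination Real.exp ((iwasawaA h).1 2 2) ^ 2 * this
  rw [hs, Real.log_pow, Real.log_exp]
  push_cast; ring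

/-- The first column of `(n exp(A) k)⁻¹` is `exp(-A₀₀)` times the first row of `k`. -/
lemma iwasawaA_zero_zero (h : G) :
    (iwasawaA h).1 0 0 = -(1 / 2) * Real.log (∑ j, (h⁻¹).1 j 0 ^ 2) := by
  obtain ⟨n, hn, k, hk, e⟩ := iwasawaA_spec h
  have hn' : ∀ i, (n⁻¹).1 i 0 = if i = 0 then 1 else 0 := by
    rw [mem_N_iff] at hn
    obtain ⟨a0, a1, a2, a3, a4, a5⟩ := hn
    intro i
    rw [Matrix.SpecialLinearGroup.coe_inv, Matrix.adjugate_fin_three]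
    fin_cases i <;> simp [a1, a2, a3, a4, a5]
  have hcol : ∀ j, (h⁻¹).1 j 0 = Real.exp (-(iwasawaA h).1 0 0) * k.1 0 j := by
    intro j
    conv_lhs => rw [e]
    rw [mul_inv_rev, Matrix.SpecialLinearGroup.coe_mul, coe_inv_of_mem_K hk, Matrix.mul_apply,
      Fin.sum_univ_three, mul_inv_rev, expA_inv, Matrix.SpecialLinearGroup.coe_mul, coe_expA,
      Matrix.diagonal_mul, Matrix.diagonal_mul, Matrix.diagonal_mul, hn' 0, hn' 1, hn' 2]
    have : (-iwasawaA h).1 0 0 = -(iwasawaA h).1 0 0 := rfl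
    simp [this, mul_comm]
  have hs : ∑ j, (h⁻¹).1 j 0 ^ 2 = Real.exp (-(iwasawaA h).1 0 0) ^ 2 := by
    rw [Fin.sum_univ_three, hcol 0, hcol 1, hcol 2]
    have := K_row_mul_row hk 0 0
    rw [if_pos rfl] at this
    linear_combination Real.exp (-(iwasawaA h).1 0 0) ^ 2 * this
  rw [hs, Real.log_pow, Real.log_exp]
  push_cast; ring

/-- The squared entries of the first column of `h⁻¹`. -/
noncomputable def colWeight (h : G) (j : Fin 3) : ℝ := (h⁻¹).1 j 0 ^ 2

/-- The squared entries of the last row of `h`. -/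
noncomputable def rowWeight (h : G) (j : Fin 3) : ℝ := h.1 2 j ^ 2

lemma colWeight_nonneg (h : G) (j : Fin 3) : 0 ≤ colWeight h j := sq_nonneg _

lemma rowWeight_nonneg (h : G) (j : Fin 3) : 0 ≤ rowWeight h j := sq_nonneg _

lemma sum_colWeight_pos (h : G) : 0 < ∑ j, colWeight h j := by
  refine (Finset.sum_nonneg fun j _ => colWeight_nonneg h j).lt_of_ne' fun h0 => ?_
  rw [Finset.sum_eq_zero_iff_of_nonneg fun j _ => colWeight_nonneg h j] at h0
  have h1 : (h * h⁻¹).1 0 0 = 1 := by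
    rw [mul_inv_cancel, Matrix.SpecialLinearGroup.coe_one, Matrix.one_apply_eq]
  rw [Matrix.SpecialLinearGroup.coe_mul, Matrix.mul_apply] at h1
  refine zero_ne_one (h1.symm.trans (Finset.sum_eq_zero fun j hj => ?_)).symm
  rw [pow_eq_zero_iff two_ne_zero |>.1 (h0 j hj), mul_zero]

lemma sum_rowWeight_pos (h : G) : 0 < ∑ j, rowWeight h j := by
  refine (Finset.sum_nonneg fun j _ => rowWeight_nonneg h j).lt_of_ne' fun h0 => ?_
  rw [Finset.sum_eq_zero_iff_of_nonneg fun j _ => rowWeight_nonneg h j] at h0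
  have h1 : (h * h⁻¹).1 2 2 = 1 := by
    rw [mul_inv_cancel, Matrix.SpecialLinearGroup.coe_one, Matrix.one_apply_eq]
  rw [Matrix.SpecialLinearGroup.coe_mul, Matrix.mul_apply] at h1
  refine zero_ne_one (h1.symm.trans (Finset.sum_eq_zero fun j hj => ?_)).symm
  rw [pow_eq_zero_iff two_ne_zero |>.1 (h0 j hj), zero_mul]

lemma iwasawaA_mul_expA_zero (h : G) (H : lieA) :
    (iwasawaA (h * expA H)).1 0 0 = -(1 / 2) * Real.log (expSum (colWeight h) (-2) H) := by
  rw [iwasawaA_zero_zero, expSum]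
  congr 3
  funext j
  rw [inv_mul_expA_apply, colWeight, mul_pow, ← Real.exp_nat_mul, mul_comm]
  congr 2
  push_cast; ring

lemma iwasawaA_mul_expA_two (h : G) (H : lieA) :
    (iwasawaA (h * expA H)).1 2 2 = 1 / 2 * Real.log (expSum (rowWeight h) 2 H) := by
  rw [iwasawaA_two_two, expSum]
  congr 3
  funext j
  rw [mul_expA_apply, rowWeight, mul_pow, ← Real.exp_nat_mul]
  push_cast; rfl

lemma dual_apply (nu : StrongDual ℝ lieA) (H : lieA) :
    nu H = nu (coroot 0 1) * H.1 0 0 + nu (coroot 2 1) * H.1 2 2 := by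
  have h : H = H.1 0 0 • coroot 0 1 + H.1 2 2 • coroot 2 1 := by
    apply Subtype.ext
    change H.1 = H.1 0 0 • (Matrix.single 0 0 1 - Matrix.single 1 1 1)
      + H.1 2 2 • (Matrix.single 2 2 1 - Matrix.single 1 1 1)
    have h1 := sum_coord H
    ext i j
    by_cases hij : i = j
    · subst hij
      fin_cases i <;> simp
      linarith
    · rw [H.2.1 i j hij]
      fin_cases i <;> fin_cases j <;> simp_all
  conv_lhs => rw [h]
  rw [map_add, map_smul, map_smul, smul_eq_mul, smul_eq_mul]
  ring

lemma phase_eq_gibbsPhase (lam nu : StrongDual ℝ lieA) (h : G) (t : ℝ) (H : lieA) :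
    -(Complex.I * t * lam H) + Complex.I * t * nu (iwasawaA (h * expA H))
      = Complex.I * t * (gibbsPhase lam (nu (coroot 0 1)) (nu (coroot 2 1))
          (colWeight h) (rowWeight h) H : ℝ) := by
  rw [dual_apply nu, iwasawaA_mul_expA_zero, iwasawaA_mul_expA_two, gibbsPhase]
  push_cast
  ring

/-! ### The slope of the phase -/

/-- The element of `𝔞` dual to `ν` for the trace form. -/
lemma exists_dual_vector {a c B : ℝ} (ha : |a| ≤ B) (hc : |c| ≤ B) :
    ∃ v : lieA, v.1 0 0 - v.1 1 1 = a ∧ v.1 2 2 - v.1 1 1 = c ∧ ‖v‖ ≤ 2 * B := by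
  obtain ⟨v, h0, h1, h2⟩ := exists_lieA ((2 * a - c) / 3) (-(a + c) / 3) ((2 * c - a) / 3)
    (by ring)
  refine ⟨v, by rw [h0, h1]; ring, by rw [h2, h1]; ring, ?_⟩
  have hB : 0 ≤ B := (abs_nonneg a).trans ha
  have hoff := v.2.1
  rw [norm_lieA, Real.sqrt_le_left (by positivity)]
  simp only [Fin.sum_univ_three]
  rw [hoff 0 1 (by decide), hoff 0 2 (by decide), hoff 1 0 (by decide), hoff 1 2 (by decide),
    hoff 2 0 (by decide), hoff 2 1 (by decide), h0, h1, h2]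
  have h3 : a ^ 2 ≤ B ^ 2 := sq_le_sq' (abs_le.1 ha).1 (abs_le.1 ha).2
  have h4 : c ^ 2 ≤ B ^ 2 := sq_le_sq' (abs_le.1 hc).1 (abs_le.1 hc).2
  nlinarith [sq_nonneg (a + c)]

/-- The rows of an orthogonal matrix: if `x ⊥ y` then `xⱼ² / |x|² + yⱼ² / |y|² ≤ 1`. -/
lemma sq_div_add_sq_div_le_one {x y x' y' x'' y'' : ℝ} (h : x * y + x' * y' + x'' * y'' = 0)
    (hx : 0 < x ^ 2 + x' ^ 2 + x'' ^ 2) (hy : 0 < y ^ 2 + y' ^ 2 + y'' ^ 2) :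
    x ^ 2 / (x ^ 2 + x' ^ 2 + x'' ^ 2) + y ^ 2 / (y ^ 2 + y' ^ 2 + y'' ^ 2) ≤ 1 := by
  rw [div_add_div _ _ hx.ne' hy.ne', div_le_one (mul_pos hx hy)]
  have h1 : (x * y) ^ 2 = (x' * y' + x'' * y'') ^ 2 := by
    rw [show x * y = -(x' * y' + x'' * y'') by linarith]; ring
  nlinarith [sq_nonneg (x' * y'' - x'' * y')]

lemma gibbs_add_gibbs_le_one (h : G) (H : lieA) (j : Fin 3) :
    gibbs (colWeight h) (-2) H j + gibbs (rowWeight h) 2 H j ≤ 1 := by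
  have h1 : (h * h⁻¹).1 2 0 = 0 := by
    rw [mul_inv_cancel, Matrix.SpecialLinearGroup.coe_one, Matrix.one_apply_ne (by decide)]
  rw [Matrix.SpecialLinearGroup.coe_mul, Matrix.mul_apply, Fin.sum_univ_three] at h1
  have hx : ∀ j, colWeight h j * Real.exp (-2 * H.1 j j)
      = ((h⁻¹).1 j 0 * Real.exp (-H.1 j j)) ^ 2 := fun j => by
    rw [colWeight, mul_pow, ← Real.exp_nat_mul]; congr 2; push_cast; ring
  have hy : ∀ j, rowWeight h j * Real.exp (2 * H.1 j j)
      = (h.1 2 j * Real.exp (H.1 j j)) ^ 2 := fun j => by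
    rw [rowWeight, mul_pow, ← Real.exp_nat_mul]; congr 2
  have hxy : ∀ j, (h⁻¹).1 j 0 * Real.exp (-H.1 j j) * (h.1 2 j * Real.exp (H.1 j j))
      = h.1 2 j * (h⁻¹).1 j 0 := fun j => by
    rw [Real.exp_neg]; field_simp
  have hX := expSum_pos (s := -2) (colWeight_nonneg h) (sum_colWeight_pos h) H
  have hY := expSum_pos (s := 2) (rowWeight_nonneg h) (sum_rowWeight_pos h) H
  simp only [gibbs, expSum, Fin.sum_univ_three, hx, hy] at hX hY ⊢
  have h0 := hxy 0
  have h1' := hxy 1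
  have h2 := hxy 2
  fin_cases j <;> simp only [Fin.zero_eta, Fin.mk_one, Fin.reduceFinMk]
  · exact sq_div_add_sq_div_le_one (by linarith) hX hY
  · have := sq_div_add_sq_div_le_one (x := (h⁻¹).1 1 0 * Real.exp (-H.1 1 1))
      (y := h.1 2 1 * Real.exp (H.1 1 1)) (x' := (h⁻¹).1 0 0 * Real.exp (-H.1 0 0))
      (y' := h.1 2 0 * Real.exp (H.1 0 0)) (x'' := (h⁻¹).1 2 0 * Real.exp (-H.1 2 2))
      (y'' := h.1 2 2 * Real.exp (H.1 2 2)) (by linarith) (by linarith) (by linarith)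
    convert! this using 3 <;> ring
  · have := sq_div_add_sq_div_le_one (x := (h⁻¹).1 2 0 * Real.exp (-H.1 2 2))
      (y := h.1 2 2 * Real.exp (H.1 2 2)) (x' := (h⁻¹).1 0 0 * Real.exp (-H.1 0 0))
      (y' := h.1 2 0 * Real.exp (H.1 0 0)) (x'' := (h⁻¹).1 1 0 * Real.exp (-H.1 1 1))
      (y'' := h.1 2 1 * Real.exp (H.1 1 1)) (by linarith) (by linarith) (by linarith)
    convert! this using 3 <;> ring

/-- The mass that the two Gibbs vectors of `h exp(H)` put outside the coordinates `0` and `2`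
respectively. It vanishes exactly when the `K`-component of `h exp(H)` lies in `M`, and is
comparable to the squared distance of that component to `M`. -/
noncomputable def defect (h : G) (H : lieA) : ℝ :=
  gibbs (colWeight h) (-2) H 1 + gibbs (colWeight h) (-2) H 2
    + (gibbs (rowWeight h) 2 H 0 + gibbs (rowWeight h) 2 H 1)

lemma defect_nonneg (h : G) (H : lieA) : 0 ≤ defect h H := by
  have h0 := gibbs_nonneg (s := -2) (colWeight_nonneg h) (sum_colWeight_pos h) H
  have h1 := gibbs_nonneg (s := 2) (rowWeight_nonneg h) (sum_rowWeight_pos h) H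
  exact add_nonneg (add_nonneg (h0 1) (h0 2)) (add_nonneg (h1 0) (h1 1))

/-- A Harnack inequality for the defect. -/
lemma defect_le (h : G) {H H' : lieA} (hH : ‖H - H'‖ ≤ 2) :
    defect h H ≤ Real.exp 8 * defect h H' := by
  have hj : ∀ j, |H.1 j j - H'.1 j j| ≤ 2 := fun j => (abs_coord_le (H - H') j).trans hH
  have h0 := gibbs_le_exp_mul (s := -2) (r := 4) (H := H) (H' := H')
    (colWeight_nonneg h) (sum_colWeight_pos h) (fun j => by
      rw [← mul_sub, abs_mul, abs_neg, abs_two]; linarith [hj j])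
  have h1 := gibbs_le_exp_mul (s := 2) (r := 4) (H := H) (H' := H')
    (rowWeight_nonneg h) (sum_rowWeight_pos h) (fun j => by
      rw [← mul_sub, abs_mul, abs_two]; linarith [hj j])
  rw [show (2 : ℝ) * 4 = 8 by norm_num] at h0 h1
  simp only [defect, mul_add]
  linarith [h0 1, h0 2, h1 0, h1 1]

lemma gibbs_col_mul_le_defect (h : G) (H : lieA) {i j : Fin 3} (hij : i ≠ j) :
    gibbs (colWeight h) (-2) H i * gibbs (colWeight h) (-2) H j ≤ defect h H := by
  have h0 := gibbs_nonneg (s := -2) (colWeight_nonneg h) (sum_colWeight_pos h) H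
  have h1 := gibbs_nonneg (s := 2) (rowWeight_nonneg h) (sum_rowWeight_pos h) H
  have h2 := gibbs_le_one (s := -2) (colWeight_nonneg h) (sum_colWeight_pos h) H
  have key : ∀ i, i ≠ 0 → gibbs (colWeight h) (-2) H i ≤ defect h H := by
    intro i hi
    have := h0 1; have := h0 2; have := h1 0; have := h1 1
    rw [defect]
    fin_cases i
    · exact absurd rfl hi
    all_goals simp only [Fin.mk_one, Fin.reduceFinMk]; linarith
  by_cases hi : i = 0
  · exact (mul_le_of_le_one_left (h0 j) (h2 i)).trans (key j fun h => hij (hi.trans h.symm))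
  · exact (mul_le_of_le_one_right (h0 i) (h2 j)).trans (key i hi)

lemma gibbs_row_mul_le_defect (h : G) (H : lieA) {i j : Fin 3} (hij : i ≠ j) :
    gibbs (rowWeight h) 2 H i * gibbs (rowWeight h) 2 H j ≤ defect h H := by
  have h0 := gibbs_nonneg (s := -2) (colWeight_nonneg h) (sum_colWeight_pos h) H
  have h1 := gibbs_nonneg (s := 2) (rowWeight_nonneg h) (sum_rowWeight_pos h) H
  have h2 := gibbs_le_one (s := 2) (rowWeight_nonneg h) (sum_rowWeight_pos h) H
  have key : ∀ i, i ≠ 2 → gibbs (rowWeight h) 2 H i ≤ defect h H := by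
    intro i hi
    have := h0 1; have := h0 2; have := h1 0; have := h1 1
    rw [defect]
    fin_cases i
    · simp only [Fin.zero_eta]; linarith
    · simp only [Fin.mk_one]; linarith
    · exact absurd rfl hi
  by_cases hi : i = 2
  · exact (mul_le_of_le_one_left (h1 j) (h2 i)).trans (key j fun h => hij (hi.trans h.symm))
  · exact (mul_le_of_le_one_right (h1 i) (h2 j)).trans (key i hi)

/-- Kostant-type convexity made quantitative. In the direction `v` dual to `ν`, the difference
`ν(v) - ∂ᵥ ν(A(h exp H))` is `½ ∑ Sᵢⱼ (vᵢ - vⱼ)²`, with `S` the doubly stochastic matrix of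
squared entries of the `K`-component; regularity of `ν` bounds it below by the defect. -/
lemma half_mul_defect_le (h : G) (H : lieA) {a c γ : ℝ} {v : lieA}
    (hva : v.1 0 0 - v.1 1 1 = a) (hvc : v.1 2 2 - v.1 1 1 = c)
    (ha : γ ≤ a ^ 2) (hc : γ ≤ c ^ 2) (hac : γ ≤ (a - c) ^ 2) :
    γ / 2 * defect h H ≤ a * v.1 0 0 + c * v.1 2 2
      - a * gibbsMean (colWeight h) (-2) H v - c * gibbsMean (rowWeight h) 2 H v := by
  have h0 := gibbs_nonneg (s := -2) (colWeight_nonneg h) (sum_colWeight_pos h) H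
  have h1 := gibbs_nonneg (s := 2) (rowWeight_nonneg h) (sum_rowWeight_pos h) H
  have s0 := sum_gibbs (s := -2) (colWeight_nonneg h) (sum_colWeight_pos h) H
  have s1 := sum_gibbs (s := 2) (rowWeight_nonneg h) (sum_rowWeight_pos h) H
  have b := gibbs_add_gibbs_le_one h H
  simp only [defect, gibbsMean, Fin.sum_univ_three]
  generalize gibbs (colWeight h) (-2) H = Q at *
  generalize gibbs (rowWeight h) 2 H = S at *
  have q0 : Q 0 = 1 - Q 1 - Q 2 := by linarith
  have r2 : S 2 = 1 - S 0 - S 1 := by linarith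
  have e : a * v.1 0 0 + c * v.1 2 2 - a * (Q 0 * v.1 0 0 + Q 1 * v.1 1 1 + Q 2 * v.1 2 2)
      - c * (S 0 * v.1 0 0 + S 1 * v.1 1 1 + S 2 * v.1 2 2)
      = 1 / 2 * (a ^ 2 * Q 1 + (a - c) ^ 2 * Q 2 + a ^ 2 * (1 - Q 0 - S 0)
        + c ^ 2 * (1 - Q 2 - S 2) + (a - c) ^ 2 * S 0 + c ^ 2 * S 1) := by
    rw [q0, r2, ← hva, ← hvc]; ring
  rw [e]
  have i1 := mul_le_mul_of_nonneg_right ha (h0 1)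
  have i2 := mul_le_mul_of_nonneg_right hac (h0 2)
  have i3 := mul_le_mul_of_nonneg_right hac (h1 0)
  have i4 := mul_le_mul_of_nonneg_right hc (h1 1)
  have i5 : 0 ≤ a ^ 2 * (1 - Q 0 - S 0) := mul_nonneg (sq_nonneg a) (by linarith [b 0])
  have i6 : 0 ≤ c ^ 2 * (1 - Q 2 - S 2) := mul_nonneg (sq_nonneg c) (by linarith [b 2])
  linarith

lemma le_two_mul_defect (h : G) (H : lieA) {a c B : ℝ} {v : lieA}
    (hva : v.1 0 0 - v.1 1 1 = a) (hvc : v.1 2 2 - v.1 1 1 = c) (ha : |a| ≤ B) (hc : |c| ≤ B) :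
    a * v.1 0 0 + c * v.1 2 2
      - a * gibbsMean (colWeight h) (-2) H v - c * gibbsMean (rowWeight h) 2 H v
      ≤ 2 * B ^ 2 * defect h H := by
  have h0 := gibbs_nonneg (s := -2) (colWeight_nonneg h) (sum_colWeight_pos h) H
  have h1 := gibbs_nonneg (s := 2) (rowWeight_nonneg h) (sum_rowWeight_pos h) H
  have s0 := sum_gibbs (s := -2) (colWeight_nonneg h) (sum_colWeight_pos h) H
  have s1 := sum_gibbs (s := 2) (rowWeight_nonneg h) (sum_rowWeight_pos h) H
  simp only [defect, gibbsMean, Fin.sum_univ_three]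
  generalize gibbs (colWeight h) (-2) H = Q at *
  generalize gibbs (rowWeight h) 2 H = S at *
  have q0 : Q 0 = 1 - Q 1 - Q 2 := by linarith
  have r2 : S 2 = 1 - S 0 - S 1 := by linarith
  have e : a * v.1 0 0 + c * v.1 2 2 - a * (Q 0 * v.1 0 0 + Q 1 * v.1 1 1 + Q 2 * v.1 2 2)
      - c * (S 0 * v.1 0 0 + S 1 * v.1 1 1 + S 2 * v.1 2 2)
      = a ^ 2 * Q 1 + (a ^ 2 - a * c) * Q 2 + (c ^ 2 - a * c) * S 0 + c ^ 2 * S 1 := by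
    rw [q0, r2, ← hva, ← hvc]; ring
  rw [e]
  have ha2 : a ^ 2 ≤ B ^ 2 := sq_le_sq' (abs_le.1 ha).1 (abs_le.1 ha).2
  have hc2 : c ^ 2 ≤ B ^ 2 := sq_le_sq' (abs_le.1 hc).1 (abs_le.1 hc).2
  have hac : -(a * c) ≤ B ^ 2 := by nlinarith [sq_nonneg (a + c)]
  have hB := sq_nonneg B
  have i1 := mul_le_mul_of_nonneg_right (show a ^ 2 ≤ 2 * B ^ 2 by linarith) (h0 1)
  have i2 := mul_le_mul_of_nonneg_right (show a ^ 2 - a * c ≤ 2 * B ^ 2 by linarith) (h0 2)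
  have i3 := mul_le_mul_of_nonneg_right (show c ^ 2 - a * c ≤ 2 * B ^ 2 by linarith) (h1 0)
  have i4 := mul_le_mul_of_nonneg_right (show c ^ 2 ≤ 2 * B ^ 2 by linarith) (h1 1)
  linarith

/-! ### The defect and the distance to `M` -/

section Log

open scoped Matrix.Norms.Frobenius Topology

/-- Rotations near the identity have a skew-symmetric logarithm of comparable size. -/
lemma exists_expK_eq : ∃ ρ : ℝ, 0 < ρ ∧ ∀ k ∈ K, √(∑ i, ∑ j, (k.1 - 1) i j ^ 2) < ρ →
    ∃ X : lieK, expK X = k ∧ ‖X‖ ≤ 2 * √(∑ i, ∑ j, (k.1 - 1) i j ^ 2) := by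
  have hs : HasStrictFDerivAt (NormedSpace.exp : Matrix (Fin 3) (Fin 3) ℝ → _)
      ((ContinuousLinearEquiv.refl ℝ (Matrix (Fin 3) (Fin 3) ℝ) :
        Matrix (Fin 3) (Fin 3) ℝ ≃L[ℝ] Matrix (Fin 3) (Fin 3) ℝ) :
        Matrix (Fin 3) (Fin 3) ℝ →L[ℝ] Matrix (Fin 3) (Fin 3) ℝ) 0 :=
    hasStrictFDerivAt_exp_zero (𝕂 := ℝ) (𝔸 := Matrix (Fin 3) (Fin 3) ℝ)
  let L := hs.localInverse NormedSpace.exp _ 0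
  have hL : Filter.Tendsto L (𝓝 1) (𝓝 0) := by
    have := hs.localInverse_tendsto
    rwa [NormedSpace.exp_zero] at this
  have hinv : ∀ᶠ y in 𝓝 (1 : Matrix (Fin 3) (Fin 3) ℝ), NormedSpace.exp (L y) = y := by
    have := hs.eventually_right_inverse
    rwa [NormedSpace.exp_zero] at this
  -- Near the origin `exp` differs from the identity by a map of Lipschitz constant `1/2`.
  have hlip : ∀ᶠ p in 𝓝 ((0, 0) : Matrix (Fin 3) (Fin 3) ℝ × Matrix (Fin 3) (Fin 3) ℝ),
      ‖NormedSpace.exp p.1 - NormedSpace.exp p.2 - (p.1 - p.2)‖ ≤ 1 / 2 * ‖p.1 - p.2‖ :=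
    hs.isLittleO.def (by norm_num)
  have hT : Filter.Tendsto (fun y => -(L y)ᵀ) (𝓝 1) (𝓝 0) := by
    have hc : Continuous fun Y : Matrix (Fin 3) (Fin 3) ℝ => -Yᵀ := by fun_prop
    have := (hc.tendsto 0).comp hL
    simp only [Matrix.transpose_zero, neg_zero] at this
    exact this
  have h1 := (hL.prodMk_nhds hT).eventually hlip
  have h2 := (hL.prodMk_nhds (tendsto_const_nhds (x := 0))).eventually hlip
  obtain ⟨ρ, hρ, hball⟩ := Metric.eventually_nhds_iff.1 (hinv.and (h1.and h2))
  refine ⟨ρ, hρ, fun k hk hkρ => ?_⟩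
  have hnorm : √(∑ i, ∑ j, (k.1 - 1) i j ^ 2) = ‖k.1 - 1‖ := by
    simp [Matrix.frobenius_norm_def, Real.sqrt_eq_rpow]
  rw [hnorm] at hkρ ⊢
  obtain ⟨e, e1, e2⟩ := hball (y := k.1) (by rwa [dist_eq_norm])
  have hk' : k.1 * k.1ᵀ = 1 := hk
  have e3 : NormedSpace.exp (-(L k.1)ᵀ) = k.1 := by
    rw [Matrix.exp_neg, Matrix.exp_transpose, e]
    exact Matrix.inv_eq_left_inv hk'
  have hskew : L k.1 = -(L k.1)ᵀ := by
    simp only [e, e3, sub_self, zero_sub, norm_neg] at e1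
    have : ‖L k.1 - -(L k.1)ᵀ‖ ≤ 0 := by linarith
    exact sub_eq_zero.1 (norm_le_zero_iff.1 this)
  refine ⟨⟨L k.1, ?_⟩, Subtype.ext e, ?_⟩
  · change (L k.1)ᵀ = -(L k.1)
    exact eq_neg_of_add_eq_zero_left (by rw [add_comm]; exact eq_neg_iff_add_eq_zero.1 hskew)
  · change ‖L k.1‖ ≤ _
    simp only [e, NormedSpace.exp_zero, sub_zero] at e2
    have h3 := norm_sub_norm_le (L k.1) (k.1 - 1)
    rw [norm_sub_rev (L k.1)] at h3
    linarith

end Log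

lemma inv_lower_eq_zero {g : G} (h10 : g.1 1 0 = 0) (h20 : g.1 2 0 = 0) (h21 : g.1 2 1 = 0) :
    (g⁻¹).1 1 0 = 0 ∧ (g⁻¹).1 2 0 = 0 ∧ (g⁻¹).1 2 1 = 0 := by
  rw [Matrix.SpecialLinearGroup.coe_inv, Matrix.adjugate_fin_three]
  simp [h10, h20, h21]

lemma lower_eq_zero_of_mem {g : G} (hg : g ∈ N * A) :
    g.1 1 0 = 0 ∧ g.1 2 0 = 0 ∧ g.1 2 1 = 0 := by
  obtain ⟨n, ⟨-, hn⟩, a, ⟨-, ha⟩, rfl⟩ := hg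
  have key : ∀ i j : Fin 3, j < i → (n * a).1 i j = 0 := by
    intro i j hij
    rw [Matrix.SpecialLinearGroup.coe_mul, Matrix.mul_apply]
    refine Finset.sum_eq_zero fun l _ => ?_
    by_cases hl : l = j
    · rw [hl, hn i j hij, zero_mul]
    · rw [ha l j hl, mul_zero]
  exact ⟨key 1 0 (by decide), key 2 0 (by decide), key 2 1 (by decide)⟩

lemma abs_apply_le_one_of_mem_K {k : G} (hk : k ∈ K) (i j : Fin 3) : |k.1 i j| ≤ 1 := by
  rw [← sq_le_one_iff_abs_le_one]
  have h := K_row_mul_row hk i i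
  rw [if_pos rfl] at h
  have := sq_nonneg (k.1 i 0); have := sq_nonneg (k.1 i 1); have := sq_nonneg (k.1 i 2)
  fin_cases j <;> simp only [Fin.zero_eta, Fin.mk_one, Fin.reduceFinMk] <;> nlinarith

lemma abs_sum_three_le {x y z X Y : ℝ} {x' y' z' : ℝ} (hx : |x| ≤ X) (hy : |y| ≤ X) (hz : |z| ≤ X)
    (hx' : |x'| ≤ Y) (hy' : |y'| ≤ Y) (hz' : |z'| ≤ Y) :
    (x * x' + y * y' + z * z') ^ 2 ≤ 9 * (X * Y) ^ 2 := by
  have hX := (abs_nonneg x).trans hx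
  have hY := (abs_nonneg x').trans hx'
  have h1 : |x * x' + y * y' + z * z'| ≤ 3 * (X * Y) := by
    refine (abs_add_three _ _ _).trans ?_
    rw [abs_mul, abs_mul, abs_mul]
    have := mul_le_mul hx hx' (abs_nonneg _) hX
    have := mul_le_mul hy hy' (abs_nonneg _) hX
    have := mul_le_mul hz hz' (abs_nonneg _) hX
    linarith
  calc _ ≤ (3 * (X * Y)) ^ 2 := sq_le_sq' (abs_le.1 h1).1 (abs_le.1 h1).2
    _ = _ := by ring

lemma sq_add_mul_le {a b x y Γ : ℝ} (ha : |a| ≤ Γ) (hb : |b| ≤ Γ) :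
    (a * x + b * y) ^ 2 ≤ 2 * Γ ^ 2 * (x ^ 2 + y ^ 2) := by
  have ha2 : a ^ 2 ≤ Γ ^ 2 := sq_le_sq' (abs_le.1 ha).1 (abs_le.1 ha).2
  have hb2 : b ^ 2 ≤ Γ ^ 2 := sq_le_sq' (abs_le.1 hb).1 (abs_le.1 hb).2
  have h1 := mul_le_mul_of_nonneg_right ha2 (sq_nonneg x)
  have h2 := mul_le_mul_of_nonneg_right ha2 (sq_nonneg y)
  have h3 := mul_le_mul_of_nonneg_right hb2 (sq_nonneg x)
  have h4 := mul_le_mul_of_nonneg_right hb2 (sq_nonneg y)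
  nlinarith [sq_nonneg (a * y - b * x)]

lemma gibbs_zero (w : Fin 3 → ℝ) (s : ℝ) (j : Fin 3) :
    gibbs w s 0 j = w j / (w 0 + w 1 + w 2) := by
  have h : ∀ i, (0 : lieA).1 i i = 0 := fun _ => rfl
  simp [gibbs, expSum, h, Fin.sum_univ_three]

/-- The off-diagonal entries in the first and last rows of `k` are controlled by the defect of
`k g`, because `g` and `g⁻¹` are upper triangular. -/
lemma offDiag_le_defect {g k : G} (hg : g ∈ N * A) (hk : k ∈ K) {Γ : ℝ}
    (hΓ : ∀ i j, |g.1 i j| ≤ Γ) (hΓ' : ∀ i j, |(g⁻¹).1 i j| ≤ Γ) :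
    k.1 0 1 ^ 2 + k.1 0 2 ^ 2 + (k.1 2 0 ^ 2 + k.1 2 1 ^ 2)
      ≤ 108 * Γ ^ 4 * defect (k * g) 0 := by
  obtain ⟨h10, h20, h21⟩ := lower_eq_zero_of_mem hg
  obtain ⟨i10, i20, -⟩ := inv_lower_eq_zero h10 h20 h21
  have i21 := (inv_lower_eq_zero h10 h20 h21).2.2
  have hΓ0 : 0 ≤ Γ := (abs_nonneg _).trans (hΓ 0 0)
  have hk1 := abs_apply_le_one_of_mem_K hk
  obtain ⟨x, hx⟩ : ∃ x : Fin 3 → ℝ, ∀ j, x j = ((k * g)⁻¹).1 j 0 := ⟨_, fun _ => rfl⟩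
  obtain ⟨y, hy⟩ : ∃ y : Fin 3 → ℝ, ∀ j, y j = (k * g).1 2 j := ⟨_, fun _ => rfl⟩
  have hkx : ∀ i, k.1 0 i = g.1 i 0 * x 0 + g.1 i 1 * x 1 + g.1 i 2 * x 2 := by
    intro i
    have : k⁻¹ = g * (k * g)⁻¹ := by group
    have h := congrArg (fun m : G => m.1 i 0) this
    simp only [Matrix.SpecialLinearGroup.coe_mul, Matrix.mul_apply, Fin.sum_univ_three] at h
    rw [coe_inv_of_mem_K hk] at h
    rw [hx, hx, hx]; exact h
  have hky : ∀ i, k.1 2 i = y 0 * (g⁻¹).1 0 i + y 1 * (g⁻¹).1 1 i + y 2 * (g⁻¹).1 2 i := by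
    intro i
    have : k = (k * g) * g⁻¹ := by group
    have h := congrArg (fun m : G => m.1 2 i) this
    rw [hy, hy, hy]
    refine h.trans ?_
    rw [Matrix.SpecialLinearGroup.coe_mul, Matrix.mul_apply, Fin.sum_univ_three]
  have hxb : ∀ j, x j ^ 2 ≤ 9 * Γ ^ 2 := by
    intro j
    have h : x j = (g⁻¹).1 j 0 * k.1 0 0 + (g⁻¹).1 j 1 * k.1 0 1 + (g⁻¹).1 j 2 * k.1 0 2 := by
      rw [hx, mul_inv_rev, Matrix.SpecialLinearGroup.coe_mul, coe_inv_of_mem_K hk,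
        Matrix.mul_apply, Fin.sum_univ_three]
      rfl
    rw [h]
    simpa using abs_sum_three_le (hΓ' j 0) (hΓ' j 1) (hΓ' j 2) (hk1 0 0) (hk1 0 1) (hk1 0 2)
  have hyb : ∀ j, y j ^ 2 ≤ 9 * Γ ^ 2 := by
    intro j
    have h : y j = k.1 2 0 * g.1 0 j + k.1 2 1 * g.1 1 j + k.1 2 2 * g.1 2 j := by
      rw [hy, Matrix.SpecialLinearGroup.coe_mul, Matrix.mul_apply, Fin.sum_univ_three]
    rw [h]
    simpa using abs_sum_three_le (hk1 2 0) (hk1 2 1) (hk1 2 2) (hΓ 0 j) (hΓ 1 j) (hΓ 2 j)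
  have hcol : ∀ j, colWeight (k * g) j = x j ^ 2 := fun j => by rw [colWeight, hx]
  have hrow : ∀ j, rowWeight (k * g) j = y j ^ 2 := fun j => by rw [rowWeight, hy]
  have hX := sum_colWeight_pos (k * g)
  have hY := sum_rowWeight_pos (k * g)
  simp only [Fin.sum_univ_three, hcol, hrow] at hX hY
  have kx : k.1 0 1 ^ 2 + k.1 0 2 ^ 2 ≤ 4 * Γ ^ 2 * (x 1 ^ 2 + x 2 ^ 2) := by
    have e1 := sq_add_mul_le (x := x 1) (y := x 2) (hΓ 1 1) (hΓ 1 2)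
    have e2 := sq_add_mul_le (x := x 1) (y := x 2) (hΓ 2 1) (hΓ 2 2)
    rw [hkx 1, hkx 2, h10, h20]
    linarith
  have ky : k.1 2 0 ^ 2 + k.1 2 1 ^ 2 ≤ 4 * Γ ^ 2 * (y 0 ^ 2 + y 1 ^ 2) := by
    have e1 := sq_add_mul_le (x := y 0) (y := y 1) (hΓ' 0 0) (hΓ' 1 0)
    have e2 := sq_add_mul_le (x := y 0) (y := y 1) (hΓ' 0 1) (hΓ' 1 1)
    rw [hky 0, hky 1, i20, i21]
    linarith
  have key : ∀ {u X : ℝ}, 0 < X → X ≤ 27 * Γ ^ 2 → 0 ≤ u →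
      4 * Γ ^ 2 * u ≤ 108 * Γ ^ 4 * (u / X) := by
    intro u X hX hXb hu
    have h1 : u ≤ 27 * Γ ^ 2 * (u / X) := by
      rw [← mul_div_assoc, le_div_iff₀ hX, mul_comm u]
      exact mul_le_mul_of_nonneg_right hXb hu
    nlinarith [mul_le_mul_of_nonneg_left h1 (show 0 ≤ 4 * Γ ^ 2 by positivity)]
  have fx := key hX (by linarith [hxb 0, hxb 1, hxb 2])
    (add_nonneg (sq_nonneg (x 1)) (sq_nonneg (x 2)))
  have fy := key hY (by linarith [hyb 0, hyb 1, hyb 2])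
    (add_nonneg (sq_nonneg (y 0)) (sq_nonneg (y 1)))
  simp only [defect, gibbs_zero, hcol, hrow]
  rw [← add_div, ← add_div, mul_add]
  linarith

lemma sq_sub_one_le {u η : ℝ} (hη : η ≤ 1) (h1 : 1 - 3 * η ≤ u) (h2 : u ≤ 1) :
    (u - 1) ^ 2 ≤ 9 * η := by
  have h3 : 0 ≤ η := by linarith
  have h4 : (1 - u) ^ 2 ≤ (3 * η) ^ 2 := pow_le_pow_left₀ (by linarith) (by linarith) 2
  nlinarith [mul_nonneg h3 (sub_nonneg.2 hη)]

/-- A rotation whose first and last rows are nearly diagonal is close to an element of `M`,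
namely the diagonal matrix of signs. -/
lemma exists_mem_M_close {k : G} (hk : k ∈ K) {η : ℝ} (hη : η ≤ 1)
    (h : k.1 0 1 ^ 2 + k.1 0 2 ^ 2 + (k.1 2 0 ^ 2 + k.1 2 1 ^ 2) ≤ η) :
    ∃ m ∈ M, m * m = 1 ∧ m * k ∈ K ∧ ∑ i, ∑ j, ((m * k).1 - 1) i j ^ 2 ≤ 33 * η := by
  obtain ⟨σ, hσ, hσk⟩ : ∃ σ : ℝ, σ * σ = 1 ∧ σ * k.1 0 0 = |k.1 0 0| := by
    rcases le_total 0 (k.1 0 0) with h0 | h0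
    · exact ⟨1, by norm_num, by rw [abs_of_nonneg h0, one_mul]⟩
    · exact ⟨-1, by norm_num, by rw [abs_of_nonpos h0]; ring⟩
  obtain ⟨τ, hτ, hτk⟩ : ∃ τ : ℝ, τ * τ = 1 ∧ τ * k.1 2 2 = |k.1 2 2| := by
    rcases le_total 0 (k.1 2 2) with h0 | h0
    · exact ⟨1, by norm_num, by rw [abs_of_nonneg h0, one_mul]⟩
    · exact ⟨-1, by norm_num, by rw [abs_of_nonpos h0]; ring⟩
  let s : Fin 3 → ℝ := ![σ, σ * τ, τ]
  have hs : ∀ i, s i * s i = 1 := by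
    intro i
    fin_cases i
    · exact hσ
    · change σ * τ * (σ * τ) = 1
      linear_combination τ * τ * hσ + hτ
    · exact hτ
  let m : G := ⟨Matrix.diagonal s, by
    rw [Matrix.det_diagonal, Fin.prod_univ_three]
    change σ * (σ * τ) * τ = 1
    linear_combination τ * τ * hσ + hτ⟩
  have hmm : m * m = 1 := by
    apply Subtype.ext
    rw [Matrix.SpecialLinearGroup.coe_mul, Matrix.SpecialLinearGroup.coe_one]
    change Matrix.diagonal s * Matrix.diagonal s = 1
    rw [Matrix.diagonal_mul_diagonal, ← Matrix.diagonal_one]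
    exact congrArg _ (funext hs)
  have hmK : m ∈ K := by
    change Matrix.diagonal s * (Matrix.diagonal s)ᵀ = 1
    rw [Matrix.diagonal_transpose, Matrix.diagonal_mul_diagonal, ← Matrix.diagonal_one]
    exact congrArg _ (funext hs)
  have hmk : ∀ i j, (m * k).1 i j = s i * k.1 i j := by
    intro i j
    rw [Matrix.SpecialLinearGroup.coe_mul]
    exact Matrix.diagonal_mul s k.1 i j
  refine ⟨m, ⟨hmK, fun H => ?_⟩, hmm, ?_, ?_⟩
  · change Matrix.diagonal s * H.1 = H.1 * Matrix.diagonal s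
    rw [lieA_eq_diagonal H, Matrix.diagonal_mul_diagonal, Matrix.diagonal_mul_diagonal]
    exact congrArg _ (funext fun i => mul_comm _ _)
  · change (m * k).1 * (m * k).1ᵀ = 1
    have h1 : m.1 * m.1ᵀ = 1 := hmK
    have h2 : k.1 * k.1ᵀ = 1 := hk
    rw [Matrix.SpecialLinearGroup.coe_mul, Matrix.transpose_mul, Matrix.mul_assoc,
      ← Matrix.mul_assoc k.1, h2, Matrix.one_mul, h1]
  · have r0 := K_row_mul_row hk 0 0
    have r2 := K_row_mul_row hk 2 2
    have c0 := K_col_mul_col hk 0 0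
    have c2 := K_col_mul_col hk 2 2
    simp only [if_true] at r0 r2 c0 c2
    -- `k⁻¹ = kᵀ` expresses the middle entry as a cofactor.
    have h11 : k.1 1 1 = k.1 0 0 * k.1 2 2 - k.1 0 2 * k.1 2 0 := by
      have e := congrFun (congrFun (coe_inv_of_mem_K hk) 1) 1
      rw [Matrix.SpecialLinearGroup.coe_inv, Matrix.adjugate_fin_three] at e
      simpa using e.symm
    simp only [← sq] at r0 r2 c0 c2
    have a0 := abs_apply_le_one_of_mem_K hk 0 0
    have a1 := abs_apply_le_one_of_mem_K hk 1 1
    have a2 := abs_apply_le_one_of_mem_K hk 2 2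
    have n01 := sq_nonneg (k.1 0 1)
    have n02 := sq_nonneg (k.1 0 2)
    have n20 := sq_nonneg (k.1 2 0)
    have n21 := sq_nonneg (k.1 2 1)
    have st : |σ * τ| = 1 := by
      rw [← pow_eq_one_iff_of_nonneg (abs_nonneg _) two_ne_zero, sq_abs]
      linear_combination τ * τ * hσ + hτ
    have d0 : 1 - η ≤ |k.1 0 0| := by
      have := mul_le_of_le_one_left (abs_nonneg (k.1 0 0)) a0
      rw [← sq, sq_abs] at this
      linarith
    have d2 : 1 - η ≤ |k.1 2 2| := by
      have := mul_le_of_le_one_left (abs_nonneg (k.1 2 2)) a2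
      rw [← sq, sq_abs] at this
      linarith
    have d1 : 1 - 3 * η ≤ σ * τ * k.1 1 1 := by
      have e : σ * τ * k.1 1 1 = |k.1 0 0| * |k.1 2 2| - σ * τ * (k.1 0 2 * k.1 2 0) := by
        rw [h11, ← hσk, ← hτk]; ring
      have e1 : σ * τ * (k.1 0 2 * k.1 2 0) ≤ η := by
        refine (le_abs_self _).trans ?_
        rw [abs_mul, st, one_mul, abs_le]
        constructor <;>
          linarith [sq_nonneg (k.1 0 2 + k.1 2 0), sq_nonneg (k.1 0 2 - k.1 2 0),
            add_sq (k.1 0 2) (k.1 2 0), sub_sq (k.1 0 2) (k.1 2 0)]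
      have e2 := mul_nonneg (sub_nonneg.2 a0) (sub_nonneg.2 a2)
      rw [e]
      linarith
    have d1' : σ * τ * k.1 1 1 ≤ 1 := by
      refine (le_abs_self _).trans ?_
      rw [abs_mul, st, one_mul]; exact a1
    have f0 : (σ * k.1 0 0 - 1) ^ 2 ≤ 9 * η := by rw [hσk]; exact sq_sub_one_le hη (by linarith) a0
    have f2 : (τ * k.1 2 2 - 1) ^ 2 ≤ 9 * η := by rw [hτk]; exact sq_sub_one_le hη (by linarith) a2
    have f1 := sq_sub_one_le hη d1 d1'
    have hoff : ∀ i j, i ≠ j → ((m * k).1 - 1) i j ^ 2 = k.1 i j ^ 2 := by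
      intro i j hij
      rw [Matrix.sub_apply, Matrix.one_apply_ne hij, hmk, sub_zero, mul_pow, sq, hs, one_mul]
    have hdiag : ∀ i, ((m * k).1 - 1) i i = s i * k.1 i i - 1 := by
      intro i
      rw [Matrix.sub_apply, Matrix.one_apply_eq, hmk]
    simp only [Fin.sum_univ_three]
    rw [hoff 0 1 (by decide), hoff 0 2 (by decide), hoff 1 0 (by decide), hoff 1 2 (by decide),
      hoff 2 0 (by decide), hoff 2 1 (by decide), hdiag, hdiag, hdiag]
    change (σ * k.1 0 0 - 1) ^ 2 + _ + _ + (_ + (σ * τ * k.1 1 1 - 1) ^ 2 + _)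
      + (_ + _ + (τ * k.1 2 2 - 1) ^ 2) ≤ _
    linarith

/-- Outside the `r`-neighbourhood of `M`, the defect of `k g` is at least of order `min 1 r²`,
uniformly for `g` in a bounded subset of `N A`. -/
lemma exists_le_defect (Γ : ℝ) : ∃ δ : ℝ, 0 < δ ∧ ∀ g ∈ N * A, (∀ i j, |g.1 i j| ≤ Γ) →
    (∀ i j, |(g⁻¹).1 i j| ≤ Γ) → ∀ k ∈ K, ∀ r : ℝ, 0 < r →
    k ∉ M * expK '' (r • Metric.closedBall 0 1) → δ * min 1 (r ^ 2) ≤ defect (k * g) 0 := by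
  obtain ⟨ρ, hρ, hlog⟩ := exists_expK_eq
  obtain ⟨δ₁, hδ₁⟩ : ∃ x, x = min 1 (min (ρ ^ 2) 1 / 133) := ⟨_, rfl⟩
  have hδ₁0 : 0 < δ₁ := by rw [hδ₁]; positivity
  refine ⟨δ₁ / (108 * Γ ^ 4 + 1), by positivity, fun g hg hΓ hΓ' k hk r hr hkr => ?_⟩
  by_contra! hlt
  apply hkr
  have hden : 0 < 108 * Γ ^ 4 + 1 := by positivity
  have hη := offDiag_le_defect hg hk hΓ hΓ'
  obtain ⟨η, hη'⟩ : ∃ x, x = 108 * Γ ^ 4 * defect (k * g) 0 := ⟨_, rfl⟩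
  rw [← hη'] at hη
  have hηlt : η < δ₁ * min 1 (r ^ 2) := by
    rw [div_mul_eq_mul_div, lt_div_iff₀ hden] at hlt
    have := defect_nonneg (k * g) 0
    rw [hη']; linarith
  have hmin : 0 < min 1 (r ^ 2) := by positivity
  have hη1 : η < δ₁ := hηlt.trans_le (mul_le_of_le_one_right hδ₁0.le (min_le_left _ _))
  have hη2 : η ≤ δ₁ * r ^ 2 :=
    hηlt.le.trans (mul_le_mul_of_nonneg_left (min_le_right _ _) hδ₁0.le)
  have b1 : δ₁ ≤ 1 := by rw [hδ₁]; exact min_le_left _ _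
  have b2 : 133 * δ₁ ≤ min (ρ ^ 2) 1 := by
    have : δ₁ ≤ min (ρ ^ 2) 1 / 133 := by rw [hδ₁]; exact min_le_right _ _
    rw [le_div_iff₀ (by norm_num)] at this; linarith
  obtain ⟨m, hm, hmm, hmk, hclose⟩ := exists_mem_M_close hk (hη1.le.trans b1) hη
  have hρlt : √(∑ i, ∑ j, ((m * k).1 - 1) i j ^ 2) < ρ := by
    rw [Real.sqrt_lt' hρ]
    linarith [min_le_left (ρ ^ 2) 1]
  obtain ⟨X, hX, hXn⟩ := hlog (m * k) hmk hρlt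
  have hXr : ‖X‖ ≤ r := by
    refine hXn.trans ?_
    rw [← le_div_iff₀' two_pos, Real.sqrt_le_left (by positivity)]
    have : 133 * δ₁ * r ^ 2 ≤ 1 * r ^ 2 :=
      mul_le_mul_of_nonneg_right (b2.trans (min_le_right _ _)) (sq_nonneg r)
    linarith [mul_nonneg hδ₁0.le (sq_nonneg r), div_pow r 2 2]
  refine ⟨m, hm, m * k, ⟨X, ?_, hX⟩, by simp only; rw [← mul_assoc, hmm, one_mul]⟩
  rw [smul_unitClosedBall]
  simpa [abs_of_pos hr] using hXr

/-! ### Uniformity over compact sets and the choice of scales -/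

lemma exists_pos_le_sq_coroot {Bstar : Set (StrongDual ℝ lieA)} (hc : IsCompact Bstar)
    (hreg : Bstar ⊆ regularDual) : ∃ γ : ℝ, 0 < γ ∧ ∀ nu ∈ Bstar, ∀ i j, i ≠ j →
      γ ≤ nu (coroot i j) ^ 2 := by
  have h : ∀ p : Fin 3 × Fin 3, ∃ X : ℝ, ∀ nu ∈ Bstar, p.1 ≠ p.2 →
      (nu (coroot p.1 p.2) ^ 2)⁻¹ ≤ X := by
    intro p
    by_cases hp : p.1 = p.2
    · exact ⟨0, fun _ _ h => absurd hp h⟩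
    · obtain ⟨X, hX⟩ := hc.exists_bound_of_continuousOn
        (f := fun nu : StrongDual ℝ lieA => (nu (coroot p.1 p.2) ^ 2)⁻¹)
        (ContinuousOn.inv₀ (by fun_prop) fun nu hnu => pow_ne_zero 2 (hreg hnu p.1 p.2 hp))
      exact ⟨X, fun nu hnu _ => (le_abs_self _).trans (hX nu hnu)⟩
  choose X hX using h
  obtain ⟨Y, hY⟩ : ∃ Y, ∀ p, X p ≤ Y := (Set.finite_range X).bddAbove.imp fun Y hY p =>
    hY ⟨p, rfl⟩
  refine ⟨(max Y 1)⁻¹, by positivity, fun nu hnu i j hij => ?_⟩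
  have hpos : 0 < nu (coroot i j) ^ 2 := by
    have := hreg hnu i j hij
    positivity
  exact inv_le_of_inv_le₀ hpos (((hX (i, j) nu hnu hij).trans (hY _)).trans (le_max_left _ _))

lemma exists_abs_coroot_le {Bstar : Set (StrongDual ℝ lieA)} (hc : IsCompact Bstar) :
    ∃ B : ℝ, 0 ≤ B ∧ ∀ nu ∈ Bstar, |nu (coroot 0 1)| ≤ B ∧ |nu (coroot 2 1)| ≤ B := by
  obtain ⟨X, hX⟩ := hc.exists_bound_of_continuousOn
    (f := fun nu : StrongDual ℝ lieA => nu (coroot 0 1)) (by fun_prop)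
  obtain ⟨Y, hY⟩ := hc.exists_bound_of_continuousOn
    (f := fun nu : StrongDual ℝ lieA => nu (coroot 2 1)) (by fun_prop)
  exact ⟨max 0 (max X Y), le_max_left _ _, fun nu hnu =>
    ⟨(hX nu hnu).trans ((le_max_left _ _).trans (le_max_right _ _)),
      (hY nu hnu).trans ((le_max_right _ _).trans (le_max_right _ _))⟩⟩

lemma exists_abs_apply_le {DB : Set G} (hc : IsCompact DB) :
    ∃ Γ : ℝ, ∀ g ∈ DB, (∀ i j, |g.1 i j| ≤ Γ) ∧ ∀ i j, |(g⁻¹).1 i j| ≤ Γ := by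
  have hcont : ∀ i j, Continuous fun g : G => g.1 i j := fun i j =>
    (continuous_apply_apply i j).comp continuous_subtype_val
  have h : ∀ p : Fin 3 × Fin 3, ∃ X : ℝ, ∀ g ∈ DB, |g.1 p.1 p.2| ≤ X ∧ |(g⁻¹).1 p.1 p.2| ≤ X := by
    intro p
    obtain ⟨X, hX⟩ := hc.exists_bound_of_continuousOn (hcont p.1 p.2).continuousOn
    obtain ⟨Y, hY⟩ := hc.exists_bound_of_continuousOn
      ((hcont p.1 p.2).comp continuous_inv).continuousOn
    exact ⟨max X Y, fun g hg =>
      ⟨(hX g hg).trans (le_max_left _ _), (hY g hg).trans (le_max_right _ _)⟩⟩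
  choose X hX using h
  obtain ⟨Y, hY⟩ : ∃ Y, ∀ p, X p ≤ Y := (Set.finite_range X).bddAbove.imp fun Y hY p =>
    hY ⟨p, rfl⟩
  exact ⟨Y, fun g hg => ⟨fun i j => (hX (i, j) g hg).1.trans (hY _),
    fun i j => (hX (i, j) g hg).2.trans (hY _)⟩⟩

/-- For `r = C t^(-1/2+ε) β^(1/2)` the squared scale `min 1 r²` beats both `1/t` and the
perturbation `β/t` by a positive power of `t`. -/
lemma le_min_one_sq {ε C t β σ : ℝ} (hσ1 : σ ≤ 1) (hσ : 0 ≤ σ) (hσε : σ ≤ 2 * ε) (ht : 1 ≤ t)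
    (hβ : 1 ≤ β) (hβt : β ≤ t ^ (1 / 2 : ℝ)) :
    min 1 (C ^ 2) * t ^ σ ≤ t * min 1 ((C * t ^ (-(1 / 2) + ε : ℝ) * β ^ (1 / 2 : ℝ)) ^ 2) ∧
    min 1 (C ^ 2) * t ^ (σ / 2) * (β / t)
      ≤ min 1 ((C * t ^ (-(1 / 2) + ε : ℝ) * β ^ (1 / 2 : ℝ)) ^ 2) := by
  have ht0 : 0 < t := by linarith
  have hβ0 : 0 < β := by linarith
  have hr : (C * t ^ (-(1 / 2) + ε : ℝ) * β ^ (1 / 2 : ℝ)) ^ 2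
      = C ^ 2 * (t ^ (2 * ε) * (β / t)) := by
    rw [mul_pow, mul_pow, ← Real.rpow_natCast (t ^ _), ← Real.rpow_natCast (β ^ _),
      ← Real.rpow_mul ht0.le, ← Real.rpow_mul hβ0.le]
    rw [show (-(1 / 2) + ε) * ((2 : ℕ) : ℝ) = 2 * ε - 1 by push_cast; ring,
      show (1 / 2 : ℝ) * ((2 : ℕ) : ℝ) = 1 by norm_num, Real.rpow_one, Real.rpow_sub_one ht0.ne']
    field_simp
  have c1 : min 1 (C ^ 2) ≤ 1 := min_le_left _ _
  have c2 : min 1 (C ^ 2) ≤ C ^ 2 := min_le_right _ _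
  have c0 : 0 ≤ min 1 (C ^ 2) := le_min zero_le_one (sq_nonneg C)
  rw [hr]
  constructor
  · rw [← div_le_iff₀' ht0, mul_div_assoc]
    refine le_min ?_ ?_
    · refine mul_le_one₀ c1 (by positivity) ?_
      rw [div_le_one ht0]
      exact (Real.rpow_le_rpow_of_exponent_le ht hσ1).trans_eq (Real.rpow_one t)
    · refine mul_le_mul c2 ?_ (by positivity) (sq_nonneg C)
      rw [← mul_div_assoc]
      refine div_le_div_of_nonneg_right ?_ ht0.le
      exact (Real.rpow_le_rpow_of_exponent_le ht hσε).trans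
        (le_mul_of_one_le_right (by positivity) hβ)
  · rw [mul_assoc]
    refine le_min ?_ ?_
    · refine mul_le_one₀ c1 (by positivity) ?_
      rw [← mul_div_assoc, div_le_one ht0]
      calc t ^ (σ / 2) * β ≤ t ^ (1 / 2 : ℝ) * t ^ (1 / 2 : ℝ) := by
            refine mul_le_mul (Real.rpow_le_rpow_of_exponent_le ht (by linarith)) hβt hβ0.le
              (by positivity)
        _ = t := by rw [← Real.rpow_add ht0]; norm_num
    · refine mul_le_mul c2 ?_ (by positivity) (sq_nonneg C)
      exact mul_le_mul_of_nonneg_right (Real.rpow_le_rpow_of_exponent_le ht (by linarith))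
        (by positivity)

/-- The data entering the oscillatory integral, restricted to those for which the defect of `h`,
times `κ`, dominates the effect of replacing the spectral parameter `lam` by `nu`. -/
structure Config (Bstar : Set (StrongDual ℝ lieA)) (R : ℝ) (n : ℕ) (κ B : ℝ) where
  /-- the amplitude -/
  b : lieA → ℂ
  /-- the large parameter -/
  t : ℝ
  /-- the first spectral parameter -/
  lam : StrongDual ℝ lieA
  /-- the second spectral parameter -/
  nu : StrongDual ℝ lieA
  /-- the element whose translate of the flat is considered -/
  h : G
  contDiff : ContDiff ℝ ∞ b
  tsupport_subset : tsupport b ⊆ Metric.closedBall 0 1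
  bound : ∀ m ≤ n, ∀ H, ‖iteratedFDeriv ℝ m b H‖ ≤ R
  t_pos : 0 < t
  nu_mem : nu ∈ Bstar
  defect_pos : 0 < defect h 0
  perturbation_le : ‖lam - nu‖ * (2 * B) ≤ κ * defect h 0

open MeasureTheory in
lemma exists_norm_integral_config_le (μ : Measure lieA) [μ.IsAddHaarMeasure]
    {Bstar : Set (StrongDual ℝ lieA)} {R B γ : ℝ} (n : ℕ) (hγ : 0 < γ) (hB0 : 0 ≤ B)
    (hB : ∀ nu ∈ Bstar, |nu (coroot 0 1)| ≤ B ∧ |nu (coroot 2 1)| ≤ B)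
    (hreg : ∀ nu ∈ Bstar, ∀ i j, i ≠ j → γ ≤ nu (coroot i j) ^ 2) :
    ∃ C, ∀ θ : Config Bstar R n (γ / 4 * Real.exp (-8)) B,
      ‖∫ H, θ.b H * Complex.exp (-(Complex.I * θ.t * θ.lam H)
        + Complex.I * θ.t * θ.nu (iwasawaA (θ.h * expA H))) ∂μ‖
        ≤ C * (θ.t * defect θ.h 0)⁻¹ ^ n := by
  obtain ⟨κ, hκ⟩ : ∃ κ, κ = γ / 4 * Real.exp (-8) := ⟨_, rfl⟩
  have hκ0 : 0 < κ := by rw [hκ]; positivity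
  rw [← hκ]
  choose v hv0 hv2 hv using fun θ : Config Bstar R n κ B =>
    exists_dual_vector (hB θ.nu θ.nu_mem).1 (hB θ.nu θ.nu_mem).2
  have hup : ∀ θ : Config Bstar R n κ B, ∀ H ∈ Metric.ball (0 : lieA) 2,
      defect θ.h H ≤ Real.exp 8 * defect θ.h 0 := fun θ H hH =>
    defect_le θ.h (by rw [sub_zero]; exact (mem_ball_zero_iff.1 hH).le)
  have hdown : ∀ θ : Config Bstar R n κ B, ∀ H ∈ Metric.ball (0 : lieA) 2,
      Real.exp (-8) * defect θ.h 0 ≤ defect θ.h H := fun θ H hH => by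
    rw [Real.exp_neg, inv_mul_le_iff₀ (Real.exp_pos _)]
    exact defect_le θ.h (by rw [zero_sub, norm_neg]; exact (mem_ball_zero_iff.1 hH).le)
  -- Replacing `λ` by `ν` in the slope costs at most `‖λ - ν‖ ‖v‖`.
  have hpert : ∀ θ : Config Bstar R n κ B, |(θ.lam - θ.nu) (v θ)| ≤ κ * defect θ.h 0 := fun θ =>
    (((θ.lam - θ.nu).le_opNorm (v θ)).trans
      (mul_le_mul_of_nonneg_left (hv θ) (norm_nonneg _))).trans θ.perturbation_le
  have hslope : ∀ (θ : Config Bstar R n κ B) (H : lieA),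
      gibbsSlope θ.lam (θ.nu (coroot 0 1)) (θ.nu (coroot 2 1)) (colWeight θ.h) (rowWeight θ.h)
        (v θ) H = (θ.lam - θ.nu) (v θ)
        + (θ.nu (coroot 0 1) * (v θ).1 0 0 + θ.nu (coroot 2 1) * (v θ).1 2 2
          - θ.nu (coroot 0 1) * gibbsMean (colWeight θ.h) (-2) H (v θ)
          - θ.nu (coroot 2 1) * gibbsMean (rowWeight θ.h) 2 H (v θ)) := by
    intro θ H
    rw [gibbsSlope, sub_apply, dual_apply θ.nu (v θ)]
    ring
  have he8 := Real.exp_pos 8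
  -- One constant serves for all the upper bounds.
  obtain ⟨B', hB'⟩ : ∃ B', B' = 2 * B + Real.exp 8 + 2 * B ^ 2 * Real.exp 8 + κ := ⟨_, rfl⟩
  have hBB' : 2 * B ≤ B' := by rw [hB']; nlinarith [sq_nonneg B]
  have he : Real.exp 8 ≤ B' := by rw [hB']; nlinarith [sq_nonneg B]
  have hBe : κ + 2 * B ^ 2 * Real.exp 8 ≤ B' := by rw [hB']; linarith
  have hfS : ∀ θ : Config Bstar R n κ B, ∀ H ∉ Metric.closedBall (0 : lieA) 1, θ.b H = 0 :=
    fun θ H hH => image_eq_zero_of_notMem_tsupport fun h => hH (θ.tsupport_subset h)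
  have hmain := norm_integral_gibbsPhase_le μ (U := Metric.ball (0 : lieA) 2)
    (S := Metric.closedBall 0 1) Metric.isOpen_ball (isCompact_closedBall 0 1)
    (Metric.closedBall_subset_ball (by norm_num)) (v := v) (lam := fun θ => θ.lam)
    (a := fun θ => θ.nu (coroot 0 1)) (c := fun θ => θ.nu (coroot 2 1)) (t := fun θ => θ.t)
    (D := fun θ => defect θ.h 0) (p := fun θ => colWeight θ.h) (q := fun θ => rowWeight θ.h)
    (B := B') (κ := κ) (f := fun θ => θ.b) (n := n)
    (fun θ => (hv θ).trans hBB')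
    (fun θ => (hB θ.nu θ.nu_mem).1.trans (by linarith))
    (fun θ => (hB θ.nu θ.nu_mem).2.trans (by linarith))
    (fun θ => θ.t_pos) (fun θ => θ.defect_pos)
    (fun θ => colWeight_nonneg θ.h) (fun θ => sum_colWeight_pos θ.h)
    (fun θ => rowWeight_nonneg θ.h) (fun θ => sum_rowWeight_pos θ.h)
    (fun θ H hH i j hij => ((gibbs_col_mul_le_defect θ.h H hij).trans (hup θ H hH)).trans
      (mul_le_mul_of_nonneg_right he θ.defect_pos.le))
    (fun θ H hH i j hij => ((gibbs_row_mul_le_defect θ.h H hij).trans (hup θ H hH)).trans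
      (mul_le_mul_of_nonneg_right he θ.defect_pos.le))
    hκ0 ?_ ?_ (UnifSmooth.of_iteratedFDeriv (fun θ => θ.contDiff) hv (fun θ => θ.bound)) hfS
  · obtain ⟨C, hC⟩ := hmain
    refine ⟨C, fun θ => ?_⟩
    simp only [phase_eq_gibbsPhase]
    exact hC θ
  · intro θ H hH
    have hac : γ ≤ (θ.nu (coroot 0 1) - θ.nu (coroot 2 1)) ^ 2 := by
      have h1 := hreg θ.nu θ.nu_mem 0 2 (by decide)
      have h2 := dual_apply θ.nu (coroot 0 2)
      have h3 : (coroot 0 2).1 0 0 = 1 := by simp [coroot]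
      have h4 : (coroot 0 2).1 2 2 = -1 := by simp [coroot]
      rw [h2, h3, h4] at h1
      convert! h1 using 2
      ring
    have h1 := half_mul_defect_le θ.h H (hv0 θ) (hv2 θ) (hreg θ.nu θ.nu_mem 0 1 (by decide))
      (hreg θ.nu θ.nu_mem 2 1 (by decide)) hac
    have h2 := mul_le_mul_of_nonneg_left (hdown θ H hH) (show 0 ≤ γ / 2 by positivity)
    have h3 : γ / 2 * (Real.exp (-8) * defect θ.h 0) = 2 * (κ * defect θ.h 0) := by
      linear_combination (-2 * defect θ.h 0) * hκ
    rw [hslope]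
    linarith [(abs_le.1 (hpert θ)).1]
  · intro θ H hH
    have h1 := le_two_mul_defect θ.h H (hv0 θ) (hv2 θ) (hB θ.nu θ.nu_mem).1
      (hB θ.nu θ.nu_mem).2
    have h2 := mul_le_mul_of_nonneg_left (hup θ H hH) (show 0 ≤ 2 * B ^ 2 by positivity)
    have h3 := mul_le_mul_of_nonneg_right hBe θ.defect_pos.le
    rw [hslope]
    linarith [(abs_le.1 (hpert θ)).2]

open MeasureTheory in
lemma norm_integral_le_of_tsupport_subset (μ : Measure lieA) {b : lieA → ℂ} {R : ℝ}
    [IsFiniteMeasureOnCompacts μ]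
    (hb : tsupport b ⊆ Metric.closedBall 0 1) (hR : ∀ H, ‖b H‖ ≤ R) (lam nu : StrongDual ℝ lieA)
    (h : G) (t : ℝ) :
    ‖∫ H, b H * Complex.exp (-(Complex.I * t * lam H)
      + Complex.I * t * nu (iwasawaA (h * expA H))) ∂μ‖
      ≤ R * μ.real (Metric.closedBall 0 1) := by
  rw [← setIntegral_eq_integral_of_forall_compl_eq_zero (s := Metric.closedBall 0 1)
    (fun H hH => by
      rw [image_eq_zero_of_notMem_tsupport fun h => hH (hb h), zero_mul])]
  refine norm_setIntegral_le_of_norm_le_const (isCompact_closedBall 0 1).measure_lt_top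
    fun H _ => ?_
  rw [phase_eq_gibbsPhase, norm_mul, mul_assoc, ← Complex.ofReal_mul, mul_comm Complex.I,
    Complex.norm_exp_ofReal_mul_I, mul_one]
  exact hR H

end SL3Flat

theorem mainTheorem6 (ε : ℝ) (hε : 0 < ε) (A₀ : ℝ) :
    ∃ n : ℕ, ∀ (μ : MeasureTheory.Measure SL3Flat.lieA) [μ.IsAddHaarMeasure]
      (Bstar : Set (StrongDual ℝ SL3Flat.lieA)) (DB : Set SL3Flat.G) (C R : ℝ),
      IsCompact Bstar → Bstar ⊆ SL3Flat.regularDual →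
      IsCompact DB → DB ⊆ SL3Flat.N * SL3Flat.A → 0 < C →
      ∃ c : ℝ, ∀ b : SL3Flat.lieA → ℂ,
        ContDiff ℝ ∞ b → tsupport b ⊆ Metric.closedBall 0 1 →
        (∀ m ≤ n, ∀ H, ‖iteratedFDeriv ℝ m b H‖ ≤ R) →
        ∀ t β : ℝ, 0 < t → 1 ≤ β → β ≤ t ^ (1 / 2 : ℝ) →
        ∀ lam ∈ Bstar, ∀ nu ∈ Bstar, ‖lam - nu‖ ≤ β / t →
        ∀ k ∈ SL3Flat.K,
          k ∉ SL3Flat.M * SL3Flat.expK ''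
            ((C * t ^ (-(1 / 2) + ε : ℝ) * β ^ (1 / 2 : ℝ)) • Metric.closedBall 0 1) →
        ∀ g ∈ DB,
          ‖∫ H, b H * Complex.exp (-(Complex.I * t * lam H)
              + Complex.I * t * nu (SL3Flat.iwasawaA (k * g * SL3Flat.expA H))) ∂μ‖
            ≤ c * t ^ (-A₀) := by
  open SL3Flat in
  obtain ⟨σ, hσ⟩ : ∃ σ, σ = min 1 (2 * ε) := ⟨_, rfl⟩
  have hσ0 : 0 < σ := by rw [hσ]; positivity
  have hσ1 : σ ≤ 1 := by rw [hσ]; exact min_le_left _ _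
  have hσε : σ ≤ 2 * ε := by rw [hσ]; exact min_le_right _ _
  -- Each integration by parts gains `t D ≳ t ^ σ`.
  refine ⟨⌈A₀ / σ⌉₊, fun μ _ Bstar DB C R hBc hreg hDc hDB hC => ?_⟩
  obtain ⟨n, hn⟩ : ∃ n, n = ⌈A₀ / σ⌉₊ := ⟨_, rfl⟩
  rw [← hn]
  have hnA : A₀ ≤ σ * n := by
    rw [hn, ← div_le_iff₀' hσ0]; exact Nat.le_ceil _
  obtain ⟨γ, hγ, hγB⟩ := exists_pos_le_sq_coroot hBc hreg
  obtain ⟨B, hB0, hB⟩ := exists_abs_coroot_le hBc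
  obtain ⟨Γ, hΓ⟩ := exists_abs_apply_le hDc
  obtain ⟨δ, hδ, hdef⟩ := exists_le_defect Γ
  obtain ⟨C₁, hC₁⟩ := exists_norm_integral_config_le μ (R := R) n hγ hB0 hB hγB
  obtain ⟨κ, hκ⟩ : ∃ κ, κ = γ / 4 * Real.exp (-8) := ⟨_, rfl⟩
  have hκ0 : 0 < κ := by rw [hκ]; positivity
  rw [← hκ] at hC₁
  obtain ⟨d, hd⟩ : ∃ d, d = δ * min 1 (C ^ 2) := ⟨_, rfl⟩
  have hd0 : 0 < d := by rw [hd]; positivity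
  -- Beyond `T` the defect dominates the perturbation `λ - ν`.
  obtain ⟨T, hT⟩ : ∃ T, T = (2 * B / (κ * d)) ^ (2 / σ) := ⟨_, rfl⟩
  have hT0 : 0 ≤ T := by rw [hT]; positivity
  refine ⟨|C₁| * d⁻¹ ^ n + |R| * μ.real (Metric.closedBall 0 1) * T ^ |A₀|, ?_⟩
  intro b hb hbs hbR t β ht0 hβ hβt lam _ nu hnu hln k hk hkM g hg
  have ht : 1 ≤ t := by
    by_contra! hlt
    exact (Real.rpow_lt_one ht0.le hlt (by norm_num : (0 : ℝ) < 1 / 2)).not_ge (hβ.trans hβt)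
  have hm0 : 0 ≤ μ.real (Metric.closedBall (0 : lieA) 1) := MeasureTheory.measureReal_nonneg
  have htA : 0 < t ^ (-A₀) := Real.rpow_pos_of_pos ht0 _
  rw [add_mul]
  by_cases htT : t ≤ T
  · have h1 := norm_integral_le_of_tsupport_subset μ hbs
      (fun H => by simpa using (hbR 0 (Nat.zero_le n) H).trans (le_abs_self R)) lam nu (k * g) t
    have h2 : 1 ≤ T ^ |A₀| * t ^ (-A₀) := by
      calc (1 : ℝ) = t ^ A₀ * t ^ (-A₀) := by rw [← Real.rpow_add ht0]; simp
        _ ≤ T ^ |A₀| * t ^ (-A₀) := by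
          refine mul_le_mul_of_nonneg_right ?_ htA.le
          exact (Real.rpow_le_rpow_of_exponent_le ht (le_abs_self A₀)).trans
            (Real.rpow_le_rpow ht0.le htT (abs_nonneg _))
    have h3 := mul_le_mul_of_nonneg_left h2
      (show 0 ≤ |R| * μ.real (Metric.closedBall (0 : lieA) 1) by positivity)
    have h4 : 0 ≤ |C₁| * d⁻¹ ^ n * t ^ (-A₀) := by positivity
    linarith
  · obtain ⟨s1, s2⟩ := le_min_one_sq (C := C) hσ1 hσ0.le hσε ht hβ hβt
    have hD := hdef g (hDB hg) (hΓ g hg).1 (hΓ g hg).2 k hk _ (by positivity) hkM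
    have hD1 : d * t ^ σ ≤ t * defect (k * g) 0 := by
      have h1 := mul_le_mul_of_nonneg_left s1 hδ.le
      have h2 := mul_le_mul_of_nonneg_left hD ht0.le
      rw [hd]
      linarith
    have hD2 : d * t ^ (σ / 2) * (β / t) ≤ defect (k * g) 0 := by
      have h1 := mul_le_mul_of_nonneg_left s2 hδ.le
      rw [hd]
      linarith
    have hDpos : 0 < defect (k * g) 0 :=
      (show 0 < d * t ^ (σ / 2) * (β / t) by positivity).trans_le hD2
    have hpert : ‖lam - nu‖ * (2 * B) ≤ κ * defect (k * g) 0 := by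
      have h1 : 2 * B ≤ κ * d * t ^ (σ / 2) := by
        rw [← div_le_iff₀' (by positivity)]
        have := Real.rpow_le_rpow hT0 (not_le.1 htT).le (show 0 ≤ σ / 2 by positivity)
        rw [hT, ← Real.rpow_mul (by positivity), div_mul_div_comm, mul_comm 2 σ,
          div_self (by positivity), Real.rpow_one] at this
        exact this
      have hβt0 : 0 ≤ β / t := by positivity
      calc ‖lam - nu‖ * (2 * B) ≤ β / t * (κ * d * t ^ (σ / 2)) :=
            mul_le_mul hln h1 (by positivity) hβt0
        _ = κ * (d * t ^ (σ / 2) * (β / t)) := by ring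
        _ ≤ κ * defect (k * g) 0 := mul_le_mul_of_nonneg_left hD2 hκ0.le
    have h1 := hC₁ ⟨b, t, lam, nu, k * g, hb, hbs, hbR, ht0, hnu, hDpos, hpert⟩
    simp only at h1
    have hpow : (t * defect (k * g) 0)⁻¹ ^ n ≤ d⁻¹ ^ n * t ^ (-A₀) := by
      calc (t * defect (k * g) 0)⁻¹ ^ n ≤ (d * t ^ σ)⁻¹ ^ n := by
            gcongr
        _ = d⁻¹ ^ n * t ^ (-(σ * n)) := by
            rw [mul_inv, mul_pow, Real.rpow_neg ht0.le, Real.rpow_mul ht0.le, Real.rpow_natCast,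
              inv_pow (t ^ σ)]
        _ ≤ d⁻¹ ^ n * t ^ (-A₀) := by
            refine mul_le_mul_of_nonneg_left ?_ (by positivity)
            exact Real.rpow_le_rpow_of_exponent_le ht (neg_le_neg hnA)
    have h2 : C₁ * (t * defect (k * g) 0)⁻¹ ^ n ≤ |C₁| * (d⁻¹ ^ n * t ^ (-A₀)) :=
      (mul_le_mul_of_nonneg_right (le_abs_self C₁) (by positivity)).trans
        (mul_le_mul_of_nonneg_left hpow (abs_nonneg C₁))
    have h3 : 0 ≤ |R| * μ.real (Metric.closedBall (0 : lieA) 1) * T ^ |A₀| * t ^ (-A₀) := by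
      positivity
    linarith
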